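/- **Setting.** The ground field is $\mathbb C$. Let $G$ be a finite group, $V$ a finite-dimensional complex representation of $G$, and $u\in G$ a central element with $u^2=1$ that acts by $-1$ on $V$. Let $S^2V\subseteq V\otimes V$ be the space of symmetric $2$-tensors, with the diagonal action of $G$, and let $(S^2V)^G$ be its subspace of $G$-invariants. Let $B\in S^2V$. Let $\mathbb C[G\ltimes V]=\mathbb C[G]\ltimes\Lambda V$ be the group algebra of the supergroup $G\ltimes V$: the semidirect product algebra, with $gv g^{-1}=g(v)$ for $g\in G$, $v\in V$, regarded as a Hopf superalgebra in which $g\in G$ is even and group-like, and $v\in V$ is odd and primitive. Let $J=e^B\in\mathbb C[G\ltimes V]^{\otimes 2}$ (super tensor product), and let $\mathbb C[G\ltimes V]^J$ be the twisted Hopf superalgebra, with the same multiplication and counit and with the coproduct $\Delta^J(x)=J^{-1}\Delta(x)J$. The Hopf algebra $A(G,V,u,B)$ has the algebra structure and counit of $\mathbb C[G\ltimes V]$, and the coproduct $$\widetilde{\Delta^J}(x)=\Delta^J_0(x)-(-1)^{|x|}(u\otimes 1)\,\Delta^J_1(x)$$ for $x$ homogeneous of parity $|x|$, where $\Delta^J=\Delta^J_0+\Delta^J_1$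 and the second tensor factor of $\Delta^J_0(x)$ is even, that of $\Delta^J_1(x)$ odd. A Hopf algebra is pointed if all its simple subcoalgebras are one-dimensional. **Corollary 5.3.** The Hopf algebra $A(G,V,u,B)$ is pointed if and only if $B\in(S^2V)^G$. Equivalently, it is pointed if and only if $A(G,V,u,B)\cong A(G,V,u,0)$ as Hopf algebras. -/

import Mathlib

open scoped TensorProduct

noncomputable section
namespace SuperHopf

section NilExp
variable {X Y : Type*} [Ring X] [Algebra ℂ X] [Ring Y] [Algebra ℂ Y]

/-- The exponential `∑ xᵏ / k!` of a nilpotent element of a complex algebra. -/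
def nilExp (x : X) : X :=
  ∑ k ∈ Finset.range (nilpotencyClass x), ((k.factorial : ℂ)⁻¹) • x ^ k

lemma nilExp_eq [Module ℚ X] (x : X) : nilExp x = IsNilpotent.exp x := by
  unfold nilExp IsNilpotent.exp
  refine Finset.sum_congr rfl fun k _ => ?_
  have := Rat.cast_smul_eq_qsmul ℂ ((k.factorial : ℚ)⁻¹) (x ^ k)
  rw [← this]; push_cast; rfl

lemma nilExp_zero : nilExp (0 : X) = 1 := by
  let _ : Module ℚ X := Module.compHom X (algebraMap ℚ ℂ)
  rw [nilExp_eq]; exact IsNilpotent.exp_zero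

lemma nilExp_add {x y : X} (h : Commute x y) (hx : IsNilpotent x) (hy : IsNilpotent y) :
    nilExp (x + y) = nilExp x * nilExp y := by
  let _ : Module ℚ X := Module.compHom X (algebraMap ℚ ℂ)
  simp only [nilExp_eq]; exact IsNilpotent.exp_add_of_commute h hx hy

lemma nilExp_mul_neg {x : X} (hx : IsNilpotent x) : nilExp x * nilExp (-x) = 1 := by
  let _ : Module ℚ X := Module.compHom X (algebraMap ℚ ℂ)
  simp only [nilExp_eq]; exact IsNilpotent.exp_mul_exp_neg_self hx

lemma nilExp_neg_mul {x : X} (hx : IsNilpotent x) : nilExp (-x) * nilExp x = 1 := by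
  let _ : Module ℚ X := Module.compHom X (algebraMap ℚ ℂ)
  simp only [nilExp_eq]; exact IsNilpotent.exp_neg_mul_exp_self hx

lemma map_nilExp (f : X →ₐ[ℂ] Y) {x : X} (hx : IsNilpotent x) :
    f (nilExp x) = nilExp (f x) := by
  let _ : Module ℚ X := Module.compHom X (algebraMap ℚ ℂ)
  let _ : Module ℚ Y := Module.compHom Y (algebraMap ℚ ℂ)
  simp only [nilExp_eq]; exact IsNilpotent.map_exp hx f

lemma nilpotent_map (f : X →ₐ[ℂ] Y) {x : X} (hx : IsNilpotent x) : IsNilpotent (f x) :=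
  hx.map f

lemma nilExp_expand {x : X} (hx : IsNilpotent x) :
    ∃ y, nilExp x = 1 + x * y ∧ nilExp x = 1 + y * x := by
  let _ : Module ℚ X := Module.compHom X (algebraMap ℚ ℂ)
  obtain ⟨n, hn⟩ := hx
  have hn' : x ^ (n + 1) = 0 := by rw [pow_succ, hn, zero_mul]
  have h : nilExp x = ∑ k ∈ Finset.range n, (((k + 1).factorial : ℚ)⁻¹) • x ^ (k + 1) + 1 := by
    rw [nilExp_eq, IsNilpotent.exp_eq_sum hn', Finset.sum_range_succ']
    simp
  refine ⟨∑ k ∈ Finset.range n, (((k + 1).factorial : ℚ)⁻¹) • x ^ k, ?_, ?_⟩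
  · rw [h, Finset.mul_sum, add_comm]
    congr 1
    refine Finset.sum_congr rfl fun k _ => ?_
    rw [← Rat.cast_smul_eq_qsmul ℂ, ← Rat.cast_smul_eq_qsmul ℂ, mul_smul_comm, pow_succ']
  · rw [h, Finset.sum_mul, add_comm]
    congr 1
    refine Finset.sum_congr rfl fun k _ => ?_
    rw [← Rat.cast_smul_eq_qsmul ℂ, ← Rat.cast_smul_eq_qsmul ℂ, smul_mul_assoc, pow_succ]

lemma commute_nilExp {x y : X} (h : Commute y x) : Commute y (nilExp x) :=
  Commute.sum_right _ _ _ fun _ _ => (h.pow_right _).smul_right _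

/-- Conjugation `x ↦ J⁻¹ x J` by a unit, as an algebra homomorphism. -/
def conjHom (J : Xˣ) : X →ₐ[ℂ] X :=
  AlgHom.ofLinearMap
    (LinearMap.mulLeft ℂ (↑J⁻¹ : X) ∘ₗ LinearMap.mulRight ℂ (J : X))
    (by simp) (by intro x y; simp [mul_assoc])

@[simp] lemma conjHom_apply (J : Xˣ) (x : X) : conjHom J x = ↑J⁻¹ * x * J := by
  simp [conjHom, mul_assoc]

end NilExp

variable {G V : Type*} [Group G] [AddCommGroup V] [Module ℂ V]

/-- The exterior algebra `ΛV`, as a type on which `G` acts through the representation `ρ`. -/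
def Lam (_ρ : Representation ℂ G V) : Type _ := ExteriorAlgebra ℂ V

instance (ρ : Representation ℂ G V) : Ring (Lam ρ) := inferInstanceAs (Ring (ExteriorAlgebra ℂ V))
instance (ρ : Representation ℂ G V) : Algebra ℂ (Lam ρ) :=
  inferInstanceAs (Algebra ℂ (ExteriorAlgebra ℂ V))

/-- The action of `G` on `ΛV` by algebra automorphisms extending the representation `ρ`. -/
instance (ρ : Representation ℂ G V) : MulSemiringAction G (Lam ρ) where
  smul g x := ExteriorAlgebra.map (ρ g) x
  one_smul x := by
    change ExteriorAlgebra.map (ρ 1) x = x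
    rw [map_one, Module.End.one_eq_id, ExteriorAlgebra.map_id]; rfl
  mul_smul g h x := by
    change ExteriorAlgebra.map (ρ (g * h)) x
      = ExteriorAlgebra.map (ρ g) (ExteriorAlgebra.map (ρ h) x)
    rw [map_mul, Module.End.mul_eq_comp, ← ExteriorAlgebra.map_comp_map]; rfl
  smul_zero g := map_zero (ExteriorAlgebra.map (ρ g))
  smul_add g := map_add (ExteriorAlgebra.map (ρ g))
  smul_one g := map_one (ExteriorAlgebra.map (ρ g))
  smul_mul g := map_mul (ExteriorAlgebra.map (ρ g))

lemma Lam.smul_def {ρ : Representation ℂ G V} (g : G) (x : Lam ρ) :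
    g • x = (ExteriorAlgebra.map (ρ g) x : ExteriorAlgebra ℂ V) := rfl

instance (ρ : Representation ℂ G V) : SMulCommClass G ℂ (Lam ρ) where
  smul_comm g c x := map_smul (ExteriorAlgebra.map (ρ g)) c x

/-- The group algebra `ℂ[G ⋉ V] = ℂ[G] ⋉ ΛV` of the supergroup `G ⋉ V`. -/
abbrev SGAlg (ρ : Representation ℂ G V) : Type _ := SkewMonoidAlgebra (Lam ρ) G

section SGAlg
variable (ρ : Representation ℂ G V)

/-- The element of `ℂ[G ⋉ V]` given by `g ∈ G`. -/
def grp : G →* SGAlg ρ := SkewMonoidAlgebra.of (Lam ρ) G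

/-- The inclusion of `ΛV` in `ℂ[G ⋉ V]`. -/
def incl : Lam ρ →ₐ[ℂ] SGAlg ρ where
  __ := SkewMonoidAlgebra.singleOneRingHom
  commutes' _ := rfl

/-- The element of `ℂ[G ⋉ V]` given by `v ∈ V`. -/
def vec : V →ₗ[ℂ] SGAlg ρ := (incl ρ).toLinearMap ∘ₗ (ExteriorAlgebra.ι ℂ : V →ₗ[ℂ] Lam ρ)

lemma incl_mul_grp (a : Lam ρ) (g : G) : incl ρ a * grp ρ g = SkewMonoidAlgebra.single g a := by
  change SkewMonoidAlgebra.single 1 a * SkewMonoidAlgebra.single g 1 = _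
  rw [SkewMonoidAlgebra.single_mul_single]; simp

lemma grp_mul_incl (a : Lam ρ) (g : G) : grp ρ g * incl ρ a = incl ρ (g • a) * grp ρ g := by
  rw [incl_mul_grp]
  change SkewMonoidAlgebra.single g 1 * SkewMonoidAlgebra.single 1 a = _
  rw [SkewMonoidAlgebra.single_mul_single]; simp

lemma grp_mul_vec (g : G) (v : V) : grp ρ g * vec ρ v = vec ρ (ρ g v) * grp ρ g := by
  change grp ρ g * incl ρ _ = incl ρ _ * _
  rw [grp_mul_incl]
  exact congrArg (fun x : Lam ρ => incl ρ x * grp ρ g) (ExteriorAlgebra.map_apply_ι (ρ g) v)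

lemma vec_mul_self (v : V) : vec ρ v * vec ρ v = 0 := by
  change incl ρ _ * incl ρ _ = 0
  rw [← map_mul]
  exact (congrArg (incl ρ) (ExteriorAlgebra.ι_sq_zero v)).trans (map_zero _)

lemma vec_mul_swap (v w : V) : vec ρ v * vec ρ w = -(vec ρ w * vec ρ v) := by
  have h := vec_mul_self ρ (v + w)
  rw [map_add, add_mul, mul_add, mul_add, vec_mul_self, vec_mul_self, zero_add, add_zero] at h
  exact eq_neg_of_add_eq_zero_left h

variable {ρ} in
/-- Algebra homomorphisms from `ℂ[G ⋉ V]` are determined on `V` and `G`. -/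
lemma sgAlg_hom_ext {X : Type*} [Semiring X] [Algebra ℂ X] {f f' : SGAlg ρ →ₐ[ℂ] X}
    (hv : ∀ v, f (vec ρ v) = f' (vec ρ v)) (hg : ∀ g, f (grp ρ g) = f' (grp ρ g)) : f = f' := by
  have h : f.comp (incl ρ) = f'.comp (incl ρ) :=
    ExteriorAlgebra.hom_ext (LinearMap.ext hv)
  refine AlgHom.toLinearMap_injective (SkewMonoidAlgebra.lhom_ext fun g a => ?_)
  have h' : f (incl ρ a) = f' (incl ρ a) := DFunLike.congr_fun h a
  rw [← incl_mul_grp]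
  simp [h', hg]

variable {ρ} in
/-- A subspace containing `1`, stable under multiplication by `V` and `G`, is everything. -/
lemma sgAlg_induction {p : SGAlg ρ → Prop} (hv : ∀ v, p (vec ρ v)) (hg : ∀ g, p (grp ρ g))
    (hc : ∀ c : ℂ, p (algebraMap ℂ _ c)) (hadd : ∀ x y, p x → p y → p (x + y))
    (hmul : ∀ x y, p x → p y → p (x * y)) (x : SGAlg ρ) : p x := by
  have h : ∀ a : Lam ρ, p (incl ρ a) := fun a =>
    ExteriorAlgebra.induction (C := fun a : ExteriorAlgebra ℂ V => p (incl ρ a))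
      (fun c => by
        have := (incl ρ).commutes c
        exact this ▸ hc c)
      hv (fun a b ha hb => by
        have := map_mul (incl ρ) a b
        exact this ▸ hmul _ _ ha hb)
      (fun a b ha hb => by
        have := map_add (incl ρ) a b
        exact this ▸ hadd _ _ ha hb) a
  induction x using SkewMonoidAlgebra.induction_on with
  | zero => simpa using hc 0
  | single g a => rw [← incl_mul_grp]; exact hmul _ _ (h a) (hg g)
  | add x y hx hy => exact hadd _ _ hx hy

variable {ρ} in
/-- The algebra homomorphism from `ℂ[G ⋉ V]` with prescribed values on `V` and on `G`. -/
def sgLift {X : Type*} [Ring X] [Algebra ℂ X] (f : V →ₗ[ℂ] X) (hf : ∀ v, f v * f v = 0)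
    (F : G →* X) (hF : ∀ g v, F g * f v = f (ρ g v) * F g) : SGAlg ρ →ₐ[ℂ] X :=
  SkewMonoidAlgebra.liftNCAlgHom (A := Lam ρ)
    (ExteriorAlgebra.lift ℂ ⟨f, hf⟩ : ExteriorAlgebra ℂ V →ₐ[ℂ] X) F (by
      intro x g
      refine ExteriorAlgebra.induction
        (C := fun x : ExteriorAlgebra ℂ V => ExteriorAlgebra.lift ℂ ⟨f, hf⟩
          (ExteriorAlgebra.map (ρ g) x) * F g = F g * ExteriorAlgebra.lift ℂ ⟨f, hf⟩ x)
        (fun c => ?_) (fun v => ?_) (fun a b ha hb => ?_) (fun a b ha hb => ?_) x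
      · simp only [AlgHom.commutes]; exact Algebra.commutes _ _
      · rw [ExteriorAlgebra.map_apply_ι, ExteriorAlgebra.lift_ι_apply,
          ExteriorAlgebra.lift_ι_apply, hF]
      · rw [map_mul, map_mul, map_mul, mul_assoc, hb, ← mul_assoc, ha, mul_assoc]
      · rw [map_add, map_add, map_add, add_mul, mul_add, ha, hb])

section
variable {X : Type*} [Ring X] [Algebra ℂ X] (f : V →ₗ[ℂ] X) (hf : ∀ v, f v * f v = 0)
    (F : G →* X) (hF : ∀ g v, F g * f v = f (ρ g v) * F g)

@[simp] lemma sgLift_vec (v : V) : sgLift f hf F hF (vec ρ v) = f v := by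
  change SkewMonoidAlgebra.liftNC _ _ (SkewMonoidAlgebra.single _ _) = _
  rw [SkewMonoidAlgebra.liftNC_single]
  simp only [map_one, mul_one]
  exact ExteriorAlgebra.lift_ι_apply ℂ f hf v

@[simp] lemma sgLift_grp (g : G) : sgLift f hf F hF (grp ρ g) = F g := by
  change SkewMonoidAlgebra.liftNC _ _ (SkewMonoidAlgebra.single _ _) = _
  rw [SkewMonoidAlgebra.liftNC_single]
  have : (ExteriorAlgebra.lift ℂ ⟨f, hf⟩ : ExteriorAlgebra ℂ V →ₐ[ℂ] X) 1 = 1 := map_one _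
  exact (congrArg (· * F g) this).trans (one_mul _)
end

/-- The `ℤ/2`-grading of `ΛV` by parity. -/
def lamParity (i : ZMod 2) : Submodule ℂ (Lam ρ) :=
  CliffordAlgebra.evenOdd (0 : QuadraticForm ℂ V) i

instance : GradedAlgebra (lamParity ρ) :=
  CliffordAlgebra.gradedAlgebra (0 : QuadraticForm ℂ V)

/-- The `ℤ/2`-grading (parity) of the superalgebra `ℂ[G ⋉ V]`: elements of `G` are even and
vectors of `V` are odd. -/
def parity (i : ZMod 2) : Submodule ℂ (SGAlg ρ) where
  carrier := {x | ∀ g, x.coeff g ∈ lamParity ρ i}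
  zero_mem' _ := zero_mem _
  add_mem' hx hy g := by simpa using add_mem (hx g) (hy g)
  smul_mem' c x hx g := by simpa using (lamParity ρ i).smul_mem c (hx g)

variable {ρ}
lemma single_mem_parity {i : ZMod 2} {a : Lam ρ} (ha : a ∈ lamParity ρ i) (g : G) :
    SkewMonoidAlgebra.single g a ∈ parity ρ i := by
  classical
  intro h
  rw [SkewMonoidAlgebra.coeff_single_apply]
  split_ifs
  · exact ha
  · exact zero_mem _

lemma smul_mem_lamParity {i : ZMod 2} {a : Lam ρ} (ha : a ∈ lamParity ρ i) (g : G) :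
    g • a ∈ lamParity ρ i := by
  have key : (CliffordAlgebra.evenOdd (0 : QuadraticForm ℂ V) i).map
      (ExteriorAlgebra.map (ρ g)).toLinearMap ≤ CliffordAlgebra.evenOdd 0 i := by
    unfold CliffordAlgebra.evenOdd
    rw [Submodule.map_iSup]
    refine iSup_mono fun j => ?_
    refine (Submodule.map_pow _ _ _).le.trans (pow_le_pow_left' ?_ _)
    rintro _ ⟨_, ⟨v, rfl⟩, rfl⟩
    exact ⟨ρ g v, (ExteriorAlgebra.map_apply_ι (ρ g) v).symm⟩
  exact key ⟨a, ha, rfl⟩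

instance : SetLike.GradedMonoid (parity ρ) where
  one_mem := single_mem_parity (SetLike.GradedOne.one_mem (A := lamParity ρ)) 1
  mul_mem i j x y hx hy := by
    rw [SkewMonoidAlgebra.mul_def]
    refine Submodule.sum_mem _ fun g _ => Submodule.sum_mem _ fun h _ => ?_
    exact single_mem_parity (SetLike.GradedMul.mul_mem (hx g) (smul_mem_lamParity (hy h) g)) _

/-- The component of parity `i` of an element of `ℂ[G ⋉ V]`. -/
def parityProj (i : ZMod 2) : SGAlg ρ →ₗ[ℂ] SGAlg ρ :=
  (SkewMonoidAlgebra.coeffLinearEquiv (S := ℂ)).symm.toLinearMap ∘ₗ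
    Finsupp.mapRange.linearMap (GradedAlgebra.proj (lamParity ρ) i) ∘ₗ
    (SkewMonoidAlgebra.coeffLinearEquiv (S := ℂ)).toLinearMap

lemma parityProj_coeff (i : ZMod 2) (x : SGAlg ρ) (g : G) :
    (parityProj i x).coeff g = GradedAlgebra.proj (lamParity ρ) i (x.coeff g) := by
  rfl

lemma parityProj_mem (i : ZMod 2) (x : SGAlg ρ) : parityProj i x ∈ parity ρ i := fun g => by
  rw [parityProj_coeff, GradedAlgebra.proj_apply]
  exact SetLike.coe_mem _

lemma parityProj_of_mem {i : ZMod 2} {x : SGAlg ρ} (hx : x ∈ parity ρ i) (j : ZMod 2) :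
    parityProj j x = if i = j then x else 0 := by
  refine SkewMonoidAlgebra.ext fun g => ?_
  rw [parityProj_coeff, GradedAlgebra.proj_apply]
  split_ifs with h
  · subst h; exact DirectSum.decompose_of_mem_same _ (hx g)
  · exact DirectSum.decompose_of_mem_ne _ (hx g) h

lemma parityProj_sum (x : SGAlg ρ) : ∑ i, parityProj i x = x := by
  classical
  refine SkewMonoidAlgebra.ext fun g => ?_
  have h := DirectSum.sum_support_decompose (lamParity ρ) (x.coeff g)
  rw [Finset.sum_subset (Finset.subset_univ _) (fun i _ hi => by
    rw [DFinsupp.notMem_support_iff.mp hi, ZeroMemClass.coe_zero])] at h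
  have h2 : ∑ i, parityProj (ρ := ρ) i x = parityProj 0 x + parityProj 1 x := Fin.sum_univ_two _
  rw [h2, SkewMonoidAlgebra.coeff_add, Finsupp.add_apply, parityProj_coeff, parityProj_coeff,
    GradedAlgebra.proj_apply, GradedAlgebra.proj_apply]
  exact (Fin.sum_univ_two (fun i : ZMod 2 =>
      (DirectSum.decompose (lamParity ρ) (x.coeff g) i : Lam ρ))).symm.trans h

instance : GradedAlgebra (parity ρ) where
  toDecomposition := DirectSum.Decomposition.ofLinearMap (parity ρ)
    (∑ i, DirectSum.lof ℂ (ZMod 2) (fun i => parity ρ i) i ∘ₗ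
      (parityProj i).codRestrict (parity ρ i) (parityProj_mem i))
    (by
      refine LinearMap.ext fun x => ?_
      simp only [LinearMap.comp_apply, LinearMap.sum_apply, map_sum, LinearMap.id_apply,
        DirectSum.coeLinearMap_lof, LinearMap.codRestrict_apply]
      exact parityProj_sum x)
    (by
      refine DirectSum.linearMap_ext _ fun i => LinearMap.ext fun x => ?_
      simp only [LinearMap.comp_apply, LinearMap.sum_apply, LinearMap.id_apply,
        DirectSum.coeLinearMap_lof]
      rw [Finset.sum_eq_single i]
      · congr 1
        ext1
        simp [parityProj_of_mem x.2]
      · intro j _ hj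
        have h0 : (parityProj j).codRestrict (parity ρ j) (parityProj_mem j) (x : SGAlg ρ) = 0 := by
          ext1
          simp [parityProj_of_mem x.2, hj.symm]
        rw [h0, map_zero]
      · simp)

lemma vec_mem (v : V) : vec ρ v ∈ parity ρ 1 :=
  single_mem_parity (CliffordAlgebra.ι_mem_evenOdd_one (0 : QuadraticForm ℂ V) v) 1

lemma grp_mem (g : G) : grp ρ g ∈ parity ρ 0 :=
  single_mem_parity (SetLike.GradedOne.one_mem (A := lamParity ρ)) g

end SGAlg

section Super
variable (ρ : Representation ℂ G V)

/-- The super tensor product `ℂ[G ⋉ V] ⊗ ℂ[G ⋉ V]`: its multiplication is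
`(a ⊗ b)(a' ⊗ b') = (-1)^(|b||a'|) aa' ⊗ bb'` for homogeneous `b` and `a'`. -/
abbrev SGAlg2 : Type _ := parity ρ ᵍ⊗[ℂ] parity ρ

variable {ρ}

lemma st_mul {i j : ZMod 2} {b a' : SGAlg ρ} (a b' : SGAlg ρ) (hb : b ∈ parity ρ j)
    (ha : a' ∈ parity ρ i) (h : j * i = 0) :
    ((a ᵍ⊗ₜ[ℂ] b : SGAlg2 ρ) * (a' ᵍ⊗ₜ[ℂ] b')) = (a * a') ᵍ⊗ₜ[ℂ] (b * b') := by
  rw [GradedTensorProduct.tmul_coe_mul_coe_tmul (parity ρ) (parity ρ) a ⟨b, hb⟩ ⟨a', ha⟩ b', h,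
    uzpow_zero, one_smul]

lemma st_mul_odd {b a' : SGAlg ρ} (a b' : SGAlg ρ) (hb : b ∈ parity ρ 1)
    (ha : a' ∈ parity ρ 1) :
    ((a ᵍ⊗ₜ[ℂ] b : SGAlg2 ρ) * (a' ᵍ⊗ₜ[ℂ] b')) = -((a * a') ᵍ⊗ₜ[ℂ] (b * b')) := by
  rw [GradedTensorProduct.tmul_coe_mul_coe_tmul (parity ρ) (parity ρ) a ⟨b, hb⟩ ⟨a', ha⟩ b',
    mul_one, uzpow_one, Units.neg_smul, one_smul]

lemma one_mem' : (1 : SGAlg ρ) ∈ parity ρ 0 := SetLike.GradedOne.one_mem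

variable (ρ)

/-- The coproduct of the Hopf superalgebra `ℂ[G ⋉ V]`: elements of `G` are group-like and vectors
of `V` are primitive. -/
def superComul : SGAlg ρ →ₐ[ℂ] SGAlg2 ρ :=
  sgLift
    ((GradedTensorProduct.includeLeft (parity ρ) (parity ρ)).toLinearMap ∘ₗ vec ρ +
      (GradedTensorProduct.includeRight (parity ρ) (parity ρ)).toLinearMap ∘ₗ vec ρ)
    (by
      intro v
      change (vec ρ v ᵍ⊗ₜ[ℂ] 1 + 1 ᵍ⊗ₜ[ℂ] vec ρ v : SGAlg2 ρ) *
        (vec ρ v ᵍ⊗ₜ[ℂ] 1 + 1 ᵍ⊗ₜ[ℂ] vec ρ v) = 0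
      rw [mul_add, add_mul, add_mul, st_mul _ _ one_mem' (vec_mem v) (zero_mul _),
        st_mul_odd _ _ (vec_mem v) (vec_mem v), st_mul _ _ one_mem' one_mem' (zero_mul _),
        st_mul _ _ (vec_mem v) one_mem' (mul_zero _)]
      simp [vec_mul_self, GradedTensorProduct.tmul])
    { toFun := fun g => grp ρ g ᵍ⊗ₜ[ℂ] grp ρ g
      map_one' := by rw [map_one]; rfl
      map_mul' := fun g h => by
        rw [st_mul _ _ (grp_mem g) (grp_mem h) (zero_mul _), map_mul] }
    (by
      intro g v
      change (grp ρ g ᵍ⊗ₜ[ℂ] grp ρ g : SGAlg2 ρ) * (vec ρ v ᵍ⊗ₜ[ℂ] 1 + 1 ᵍ⊗ₜ[ℂ] vec ρ v) =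
        (vec ρ (ρ g v) ᵍ⊗ₜ[ℂ] 1 + 1 ᵍ⊗ₜ[ℂ] vec ρ (ρ g v)) * (grp ρ g ᵍ⊗ₜ[ℂ] grp ρ g)
      rw [mul_add, add_mul, st_mul _ _ (grp_mem g) (vec_mem v) (zero_mul _),
        st_mul _ _ (grp_mem g) one_mem' (zero_mul _), st_mul _ _ one_mem' (grp_mem g) (zero_mul _),
        st_mul _ _ (vec_mem _) (grp_mem g) (mul_zero _), grp_mul_vec]
      simp only [mul_one, one_mul])

lemma superComul_vec (v : V) :
    superComul ρ (vec ρ v) = vec ρ v ᵍ⊗ₜ[ℂ] 1 + 1 ᵍ⊗ₜ[ℂ] vec ρ v :=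
  sgLift_vec _ _ _ _ _ v

lemma superComul_grp (g : G) : superComul ρ (grp ρ g) = grp ρ g ᵍ⊗ₜ[ℂ] grp ρ g :=
  sgLift_grp _ _ _ _ _ g

/-- The inclusion of `V ⊗ V` in the super tensor square of `ℂ[G ⋉ V]`. -/
def tens : V ⊗[ℂ] V →ₗ[ℂ] SGAlg2 ρ :=
  (GradedTensorProduct.of ℂ (parity ρ) (parity ρ)).toLinearMap ∘ₗ
    TensorProduct.map (vec ρ) (vec ρ)

variable {ρ}

lemma tens_tmul (v w : V) : tens ρ (v ⊗ₜ w) = vec ρ v ᵍ⊗ₜ[ℂ] vec ρ w := rfl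

lemma tens_commute (s t : V ⊗[ℂ] V) : Commute (tens ρ s) (tens ρ t) := by
  induction s using TensorProduct.induction_on with
  | zero => simp
  | add x y hx hy => rw [map_add]; exact hx.add_left hy
  | tmul v w =>
    induction t using TensorProduct.induction_on with
    | zero => simp
    | add x y hx hy => rw [map_add]; exact hx.add_right hy
    | tmul v' w' =>
      rw [commute_iff_eq, tens_tmul, tens_tmul, st_mul_odd _ _ (vec_mem _) (vec_mem _),
        st_mul_odd _ _ (vec_mem _) (vec_mem _), vec_mul_swap ρ v v', vec_mul_swap ρ w w',
        GradedTensorProduct.tmul, TensorProduct.neg_tmul, TensorProduct.tmul_neg, neg_neg]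

lemma tens_nilpotent (t : V ⊗[ℂ] V) : IsNilpotent (tens ρ t) := by
  induction t using TensorProduct.induction_on with
  | zero => simp
  | add x y hx hy => rw [map_add]; exact (tens_commute x y).isNilpotent_add hx hy
  | tmul v w =>
    refine ⟨2, ?_⟩
    rw [pow_two, tens_tmul, st_mul_odd _ _ (vec_mem _) (vec_mem _), vec_mul_self]
    simp

variable (ρ) in
/-- The twist `J = e^B` of the Hopf superalgebra `ℂ[G ⋉ V]`. -/
def superTwist (B : V ⊗[ℂ] V) : (SGAlg2 ρ)ˣ where
  val := nilExp (tens ρ B)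
  inv := nilExp (-tens ρ B)
  val_inv := nilExp_mul_neg (tens_nilpotent B)
  inv_val := nilExp_neg_mul (tens_nilpotent B)

variable (ρ) in
/-- The coproduct `Δ^J(x) = J⁻¹ Δ(x) J` of the twisted Hopf superalgebra `ℂ[G ⋉ V]^J`,
where `J = e^B`. -/
def twistedComul (B : V ⊗[ℂ] V) : SGAlg ρ →ₐ[ℂ] SGAlg2 ρ :=
  (conjHom (superTwist ρ B)).comp (superComul ρ)

lemma twistedComul_vec (B : V ⊗[ℂ] V) (v : V) :
    twistedComul ρ B (vec ρ v) = vec ρ v ᵍ⊗ₜ[ℂ] 1 + 1 ᵍ⊗ₜ[ℂ] vec ρ v := by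
  have h : Commute (superComul ρ (vec ρ v)) (tens ρ B) := by
    rw [superComul_vec]
    induction B using TensorProduct.induction_on with
    | zero => simp
    | add x y hx hy => rw [map_add]; exact hx.add_right hy
    | tmul w w' =>
      refine Commute.add_left ?_ ?_ <;> rw [commute_iff_eq, tens_tmul]
      · rw [st_mul _ _ one_mem' (vec_mem _) (zero_mul _), st_mul_odd _ _ (vec_mem _) (vec_mem _),
          vec_mul_swap ρ v w, GradedTensorProduct.tmul, TensorProduct.neg_tmul]
        simp
      · rw [st_mul_odd _ _ (vec_mem _) (vec_mem _), st_mul _ _ (vec_mem _) one_mem' (mul_zero _),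
          vec_mul_swap ρ v w', GradedTensorProduct.tmul, TensorProduct.tmul_neg]
        simp
  have h' : Commute (superComul ρ (vec ρ v)) (superTwist ρ B : SGAlg2 ρ) := commute_nilExp h
  change conjHom (superTwist ρ B) (superComul ρ (vec ρ v)) = _
  rw [conjHom_apply, mul_assoc, h'.eq, Units.inv_mul_cancel_left, superComul_vec]


lemma twistedComul_grp (B : V ⊗[ℂ] V) (g : G) :
    twistedComul ρ B (grp ρ g) =
      (↑(superTwist ρ B)⁻¹ : SGAlg2 ρ) * (grp ρ g ᵍ⊗ₜ[ℂ] grp ρ g) * (superTwist ρ B : SGAlg2 ρ) := by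
  change conjHom (superTwist ρ B) (superComul ρ (grp ρ g)) = _
  rw [conjHom_apply, superComul_grp]

end Super

/-- A supergroup `G ⋉ V` with its parity element: a representation `V` of `G` and a central
element `u ∈ G` with `u² = 1` that acts by `-1` on `V`. -/
structure SuperGroupDatum (G V : Type*) [Group G] [AddCommGroup V] [Module ℂ V] where
  /-- the representation of `G` on `V` -/
  ρ : Representation ℂ G V
  /-- the parity element -/
  u : G
  u_central : u ∈ Subgroup.center G
  u_sq : u ^ 2 = 1
  u_act : ∀ v, ρ u v = -v

section Boson
variable (D : SuperGroupDatum G V)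

/-- The element of `ℂ[G ⋉ V]` given by the parity element `u`. -/
def uu : SGAlg D.ρ := grp D.ρ D.u

lemma uu_mul_uu : uu D * uu D = 1 := by
  unfold uu; rw [← map_mul, ← pow_two, D.u_sq, map_one]

lemma uu_mul_vec (v : V) : uu D * vec D.ρ v = -(vec D.ρ v * uu D) := by
  unfold uu; rw [grp_mul_vec, D.u_act, map_neg, neg_mul]

lemma uu_mul_grp (g : G) : uu D * grp D.ρ g = grp D.ρ g * uu D := by
  unfold uu; rw [← map_mul, ← map_mul, Subgroup.mem_center_iff.mp D.u_central g]

lemma uu_pow_add (i j : ZMod 2) :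
    uu D ^ (i + j).val = uu D ^ i.val * uu D ^ j.val := by
  have h := uu_mul_uu D
  fin_cases i <;> fin_cases j
  · exact (one_mul _).symm
  · exact (one_mul _).symm
  · exact (mul_one _).symm
  · change uu D ^ 0 = uu D ^ 1 * uu D ^ 1
    rw [pow_one, h, pow_zero]

variable {D}

lemma uu_act (a : Lam D.ρ) :
    D.u • a = (CliffordAlgebra.involute (Q := (0 : QuadraticForm ℂ V)) a : Lam D.ρ) := by
  have h : ExteriorAlgebra.map (D.ρ D.u) =
      CliffordAlgebra.involute (Q := (0 : QuadraticForm ℂ V)) := by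
    refine ExteriorAlgebra.hom_ext (LinearMap.ext fun v => ?_)
    refine (ExteriorAlgebra.map_apply_ι _ v).trans ?_
    rw [D.u_act, map_neg]
    exact (CliffordAlgebra.involute_ι v).symm
  exact DFunLike.congr_fun h a

/-- `u` commutes with even elements and anticommutes with odd elements. -/
lemma uu_pow_mul {i : ZMod 2} {a : SGAlg D.ρ} (ha : a ∈ parity D.ρ i) (j : ZMod 2) :
    a * uu D ^ j.val = (-1 : ℤˣ) ^ (j * i) • (uu D ^ j.val * a) := by
  have z2 : ∀ k : ZMod 2, k = 0 ∨ k = 1 := by decide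
  have key : ∀ c : ℂ, (∀ α : Lam D.ρ, α ∈ lamParity D.ρ i → D.u • α = c • α) →
      uu D * a = c • (a * uu D) := by
    intro c hL
    have hs : ∑ g ∈ a.support, SkewMonoidAlgebra.single g (a.coeff g) = a :=
      SkewMonoidAlgebra.sum_single a
    conv_lhs => rw [← hs]
    conv_rhs => rw [← hs]
    rw [Finset.mul_sum, Finset.sum_mul, Finset.smul_sum]
    refine Finset.sum_congr rfl fun g _ => ?_
    rw [← incl_mul_grp, ← mul_assoc, uu, grp_mul_incl, hL _ (ha g), mul_assoc, ← uu, uu_mul_grp,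
      ← mul_assoc, map_smul, smul_mul_assoc, smul_mul_assoc]
  have h1 : uu D ^ (1 : ZMod 2).val = uu D := pow_one _
  obtain rfl | rfl := z2 j
  · simp
  obtain rfl | rfl := z2 i
  · have := key 1 fun α hα => by
      rw [uu_act, one_smul]; exact CliffordAlgebra.involute_eq_of_mem_even hα
    rw [h1, mul_zero, uzpow_zero, one_smul, this, one_smul]
  · have := key (-1) fun α hα => by
      rw [uu_act, neg_smul, one_smul]; exact CliffordAlgebra.involute_eq_of_mem_odd hα
    rw [h1, mul_one, uzpow_one, Units.neg_smul, one_smul, this, neg_smul, one_smul, neg_neg]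

variable (D)

/-- The homomorphism `b ↦ u^|b| ⊗ b`. -/
def bosonRightLin : SGAlg D.ρ →ₗ[ℂ] SGAlg D.ρ ⊗[ℂ] SGAlg D.ρ :=
  ∑ i : ZMod 2, TensorProduct.mk ℂ _ _ (uu D ^ i.val) ∘ₗ parityProj i

lemma bosonRightLin_apply {i : ZMod 2} {b : SGAlg D.ρ} (hb : b ∈ parity D.ρ i) :
    bosonRightLin D b = (uu D ^ i.val) ⊗ₜ b := by
  simp only [bosonRightLin, LinearMap.sum_apply, LinearMap.comp_apply, parityProj_of_mem hb]
  rw [Finset.sum_eq_single i]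
  · simp
  · intro j _ hj; simp [hj.symm]
  · simp

/-- The algebra homomorphism `b ↦ u^|b| ⊗ b`. -/
def bosonRight : SGAlg D.ρ →ₐ[ℂ] SGAlg D.ρ ⊗[ℂ] SGAlg D.ρ :=
  AlgHom.ofLinearMap (bosonRightLin D)
    (by rw [bosonRightLin_apply D one_mem']; simp [Algebra.TensorProduct.one_def])
    (by
      rw [LinearMap.map_mul_iff]
      refine DirectSum.decompose_lhom_ext (parity D.ρ) fun i => LinearMap.ext fun a => ?_
      refine DirectSum.decompose_lhom_ext (parity D.ρ) fun j => LinearMap.ext fun b => ?_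
      change bosonRightLin D (a * b : SGAlg D.ρ) = bosonRightLin D a * bosonRightLin D b
      rw [bosonRightLin_apply D a.2, bosonRightLin_apply D b.2,
        bosonRightLin_apply D (SetLike.GradedMul.mul_mem a.2 b.2),
        Algebra.TensorProduct.tmul_mul_tmul, uu_pow_add])

lemma bosonRight_apply {i : ZMod 2} {b : SGAlg D.ρ} (hb : b ∈ parity D.ρ i) :
    bosonRight D b = (uu D ^ i.val) ⊗ₜ b := bosonRightLin_apply D hb

/-- The passage from the super tensor square to the ordinary tensor square: the algebra
homomorphism `a ⊗ b ↦ a u^|b| ⊗ b`. Since `u` commutes with even and anticommutes with odd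
elements, it sends a coproduct `Δ(x) = Δ₀(x) + Δ₁(x)`, with `Δᵢ(x)` having second tensor factor of
parity `i`, to `Δ₀(x) - (-1)^|x| (u ⊗ 1) Δ₁(x)`. -/
def bosonize : SGAlg2 D.ρ →ₐ[ℂ] SGAlg D.ρ ⊗[ℂ] SGAlg D.ρ :=
  GradedTensorProduct.lift (parity D.ρ) (parity D.ρ)
    Algebra.TensorProduct.includeLeft (bosonRight D) (by
      intro i j a b
      rw [bosonRight_apply D b.2, Algebra.TensorProduct.includeLeft_apply,
        Algebra.TensorProduct.tmul_mul_tmul, Algebra.TensorProduct.tmul_mul_tmul, one_mul, mul_one,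
        uu_pow_mul a.2]
      rfl)

lemma bosonize_apply {i : ZMod 2} (a : SGAlg D.ρ) {b : SGAlg D.ρ} (hb : b ∈ parity D.ρ i) :
    bosonize D (a ᵍ⊗ₜ[ℂ] b) = (a * uu D ^ i.val) ⊗ₜ b := by
  unfold bosonize
  rw [GradedTensorProduct.lift_tmul, bosonRight_apply D hb]
  simp


/-- For odd `b`, the passage to the ordinary tensor square reads
`a ⊗ b ↦ (-1)^|a| (u ⊗ 1)(a ⊗ b)`. -/
lemma bosonize_odd {i : ZMod 2} {a b : SGAlg D.ρ} (ha : a ∈ parity D.ρ i)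
    (hb : b ∈ parity D.ρ 1) :
    bosonize D (a ᵍ⊗ₜ[ℂ] b) = (-1 : ℤˣ) ^ i • ((uu D ⊗ₜ[ℂ] 1) * (a ⊗ₜ[ℂ] b)) := by
  have h1 : uu D ^ (1 : ZMod 2).val = uu D := pow_one _
  have h := uu_pow_mul ha 1
  rw [h1, one_mul] at h
  rw [bosonize_apply D a hb, h1, h, Algebra.TensorProduct.tmul_mul_tmul, one_mul]
  rfl

/-- The coproduct of `A(G, V, u, B)`: the coproduct `Δ^J` of the Hopf superalgebra `ℂ[G ⋉ V]^J`,
`J = e^B`, modified by `u` into the coproduct of an ordinary Hopf algebra. -/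
def comulHom (B : V ⊗[ℂ] V) : SGAlg D.ρ →ₐ[ℂ] SGAlg D.ρ ⊗[ℂ] SGAlg D.ρ :=
  (bosonize D).comp (twistedComul D.ρ B)

/-- The counit: `g ↦ 1` for `g ∈ G` and `v ↦ 0` for `v ∈ V`. -/
def counitHom (ρ : Representation ℂ G V) : SGAlg ρ →ₐ[ℂ] ℂ :=
  sgLift 0 (by simp) 1 (by simp)

@[simp] lemma counitHom_vec (ρ : Representation ℂ G V) (v : V) : counitHom ρ (vec ρ v) = 0 :=
  sgLift_vec _ _ _ _ _ v

@[simp] lemma counitHom_grp (ρ : Representation ℂ G V) (g : G) : counitHom ρ (grp ρ g) = 1 :=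
  sgLift_grp _ _ _ _ _ g

/-- The antipode as an algebra homomorphism to the opposite algebra: `g ↦ g⁻¹` for `g ∈ G` and
`v ↦ -uv` for `v ∈ V`. -/
def antipodeOp : SGAlg D.ρ →ₐ[ℂ] (SGAlg D.ρ)ᵐᵒᵖ :=
  sgLift
    ((MulOpposite.opLinearEquiv ℂ).toLinearMap ∘ₗ LinearMap.mulLeft ℂ (-uu D) ∘ₗ vec D.ρ)
    (by
      intro v
      change MulOpposite.op (-uu D * vec D.ρ v) * MulOpposite.op (-uu D * vec D.ρ v) = 0
      rw [← MulOpposite.op_mul, neg_mul, uu_mul_vec, neg_neg, mul_assoc, ← mul_assoc (uu D),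
        uu_mul_vec, neg_mul, mul_neg, ← mul_assoc, ← mul_assoc, vec_mul_self]
      simp)
    { toFun := fun g => MulOpposite.op (grp D.ρ g⁻¹)
      map_one' := by simp
      map_mul' := fun g h => by simp }
    (by
      intro g v
      change MulOpposite.op (grp D.ρ g⁻¹) * MulOpposite.op (-uu D * vec D.ρ v) =
        MulOpposite.op (-uu D * vec D.ρ (D.ρ g v)) * MulOpposite.op (grp D.ρ g⁻¹)
      rw [← MulOpposite.op_mul, ← MulOpposite.op_mul, neg_mul, neg_mul, neg_mul, mul_neg,
        ← mul_assoc, ← uu_mul_grp, mul_assoc, mul_assoc, grp_mul_vec, ← Module.End.mul_apply,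
        ← map_mul, inv_mul_cancel, map_one, Module.End.one_apply])

/-- The antipode of `A(G, V, u, B)`. -/
def antipodeLin : SGAlg D.ρ →ₗ[ℂ] SGAlg D.ρ :=
  (MulOpposite.opLinearEquiv ℂ).symm.toLinearMap ∘ₗ (antipodeOp D).toLinearMap

lemma antipode_mul (x y : SGAlg D.ρ) :
    antipodeLin D (x * y) = antipodeLin D y * antipodeLin D x := by
  simp [antipodeLin]

lemma antipode_one : antipodeLin D 1 = 1 := by
  simp [antipodeLin]

lemma antipode_vec (v : V) : antipodeLin D (vec D.ρ v) = -(uu D * vec D.ρ v) := by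
  have h : antipodeOp D (vec D.ρ v) = MulOpposite.op (-uu D * vec D.ρ v) :=
    sgLift_vec _ _ _ _ _ v
  simp [antipodeLin, h]

lemma antipode_grp (g : G) : antipodeLin D (grp D.ρ g) = grp D.ρ g⁻¹ := by
  have h : antipodeOp D (grp D.ρ g) = MulOpposite.op (grp D.ρ g⁻¹) :=
    sgLift_grp _ _ _ _ _ g
  simp [antipodeLin, h]

lemma antipode_uu : antipodeLin D (uu D) = uu D := by
  unfold uu
  rw [antipode_grp]
  congr 1
  exact inv_eq_of_mul_eq_one_left (by rw [← pow_two, D.u_sq])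

/-- The image of `B` in the ordinary tensor square. -/
def bten : V ⊗[ℂ] V →ₗ[ℂ] SGAlg D.ρ ⊗[ℂ] SGAlg D.ρ :=
  (bosonize D).toLinearMap ∘ₗ tens D.ρ

lemma bten_tmul (v w : V) : bten D (v ⊗ₜ w) = (vec D.ρ v * uu D) ⊗ₜ vec D.ρ w := by
  change bosonize D (vec D.ρ v ᵍ⊗ₜ[ℂ] vec D.ρ w) = _
  rw [bosonize_apply D _ (vec_mem w)]
  congr 2
  exact pow_one _

lemma bten_nilpotent (t : V ⊗[ℂ] V) : IsNilpotent (bten D t) :=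
  (tens_nilpotent t).map (bosonize D)

/-- The twist `J = e^B` in the ordinary tensor square. -/
def twist (B : V ⊗[ℂ] V) : (SGAlg D.ρ ⊗[ℂ] SGAlg D.ρ)ˣ where
  val := nilExp (bten D B)
  inv := nilExp (-bten D B)
  val_inv := nilExp_mul_neg (bten_nilpotent D B)
  inv_val := nilExp_neg_mul (bten_nilpotent D B)

lemma comul_vec (B : V ⊗[ℂ] V) (v : V) :
    comulHom D B (vec D.ρ v) = vec D.ρ v ⊗ₜ 1 + uu D ⊗ₜ vec D.ρ v := by
  change bosonize D (twistedComul D.ρ B (vec D.ρ v)) = _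
  have h1 : uu D ^ (1 : ZMod 2).val = uu D := pow_one _
  have h0 : uu D ^ (0 : ZMod 2).val = 1 := pow_zero _
  rw [twistedComul_vec, map_add, bosonize_apply D _ one_mem', bosonize_apply D _ (vec_mem v), h0, h1,
    mul_one, one_mul]

lemma comul_grp (B : V ⊗[ℂ] V) (g : G) :
    comulHom D B (grp D.ρ g) = conjHom (twist D B) (grp D.ρ g ⊗ₜ grp D.ρ g) := by
  change bosonize D (twistedComul D.ρ B (grp D.ρ g)) = _
  have h0 : uu D ^ (0 : ZMod 2).val = 1 := pow_zero _
  have ha : bosonize D (superTwist D.ρ B : SGAlg2 D.ρ) = twist D B :=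
    map_nilExp _ (tens_nilpotent B)
  have hb : bosonize D (↑(superTwist D.ρ B)⁻¹ : SGAlg2 D.ρ) = ↑(twist D B)⁻¹ := by
    refine (map_nilExp (bosonize D) (tens_nilpotent B).neg).trans ?_
    rw [map_neg]; rfl
  rw [twistedComul_grp, map_mul, map_mul, ha, hb, bosonize_apply D _ (grp_mem g), h0, mul_one,
    conjHom_apply]

lemma uu_commute_bten (t : V ⊗[ℂ] V) : Commute (uu D ⊗ₜ[ℂ] uu D) (bten D t) := by
  induction t using TensorProduct.induction_on with
  | zero => simp
  | add x y hx hy => rw [map_add]; exact hx.add_right hy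
  | tmul v w =>
    rw [commute_iff_eq, bten_tmul, Algebra.TensorProduct.tmul_mul_tmul,
      Algebra.TensorProduct.tmul_mul_tmul, ← mul_assoc, uu_mul_vec, uu_mul_vec, neg_mul,
      TensorProduct.neg_tmul, TensorProduct.tmul_neg, neg_neg]

lemma comul_uu (B : V ⊗[ℂ] V) : comulHom D B (uu D) = uu D ⊗ₜ uu D := by
  unfold uu
  rw [comul_grp, conjHom_apply, mul_assoc]
  have h : Commute (uu D ⊗ₜ[ℂ] uu D) (twist D B : SGAlg D.ρ ⊗[ℂ] SGAlg D.ρ) :=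
    commute_nilExp (uu_commute_bten D B)
  change _ * (uu D ⊗ₜ[ℂ] uu D * _) = uu D ⊗ₜ[ℂ] uu D
  rw [h.eq, Units.inv_mul_cancel_left]

lemma comul_vec_uu (B : V ⊗[ℂ] V) (v : V) : comulHom D B (vec D.ρ v * uu D) =
    (vec D.ρ v * uu D) ⊗ₜ uu D + 1 ⊗ₜ (vec D.ρ v * uu D) := by
  rw [map_mul, comul_vec, comul_uu, add_mul, Algebra.TensorProduct.tmul_mul_tmul,
    Algebra.TensorProduct.tmul_mul_tmul, uu_mul_uu, one_mul]


lemma vec_commute_bten (v : V) (t : V ⊗[ℂ] V) :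
    Commute (vec D.ρ v ⊗ₜ[ℂ] 1 + uu D ⊗ₜ[ℂ] vec D.ρ v) (bten D t) := by
  induction t using TensorProduct.induction_on with
  | zero => simp
  | add x y hx hy => rw [map_add]; exact hx.add_right hy
  | tmul w w' =>
    rw [bten_tmul]
    refine Commute.add_left ?_ ?_ <;> rw [commute_iff_eq, Algebra.TensorProduct.tmul_mul_tmul,
      Algebra.TensorProduct.tmul_mul_tmul]
    · rw [one_mul, mul_one, mul_assoc, uu_mul_vec, mul_neg, ← mul_assoc, ← mul_assoc,
        vec_mul_swap D.ρ v w, neg_mul]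
    · rw [← mul_assoc, uu_mul_vec, neg_mul, vec_mul_swap D.ρ v w', TensorProduct.neg_tmul,
        TensorProduct.tmul_neg, neg_neg]

lemma comul_vec_uu_commute (B t : V ⊗[ℂ] V) (v : V) :
    Commute (comulHom D B (vec D.ρ v * uu D)) (bten D t) := by
  rw [map_mul, comul_vec, comul_uu]
  exact (vec_commute_bten D v t).mul_left (uu_commute_bten D t)

lemma comul_vec_commute (B t : V ⊗[ℂ] V) (v : V) :
    Commute (comulHom D B (vec D.ρ v)) (bten D t) := by
  rw [comul_vec]
  exact vec_commute_bten D v t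

lemma conj_exp_aux {X : Type*} [Ring X] [Algebra ℂ X] {a b : X} (c : X) (ha : IsNilpotent a)
    (hb : IsNilpotent b) (h : Commute a b) :
    nilExp (-a) * (nilExp (-b) * c * nilExp b) * nilExp a =
      nilExp (-(a + b)) * c * nilExp (a + b) := by
  rw [neg_add, nilExp_add (h.neg_left.neg_right) ha.neg hb.neg, add_comm a b,
    nilExp_add h.symm hb ha]
  simp only [mul_assoc]

set_option maxHeartbeats 800000 in
lemma comul_coassoc (B : V ⊗[ℂ] V) :
    (Algebra.TensorProduct.assoc ℂ ℂ ℂ (SGAlg D.ρ) (SGAlg D.ρ) (SGAlg D.ρ)).toAlgHom.comp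
      ((Algebra.TensorProduct.map (comulHom D B) (.id ℂ _)).comp (comulHom D B))
      = (Algebra.TensorProduct.map (.id ℂ _) (comulHom D B)).comp (comulHom D B) := by
  have assoc_apply : ∀ x y z : SGAlg D.ρ,
      (Algebra.TensorProduct.assoc ℂ ℂ ℂ (SGAlg D.ρ) (SGAlg D.ρ) (SGAlg D.ρ)).toAlgHom
        ((x ⊗ₜ y) ⊗ₜ z) = x ⊗ₜ (y ⊗ₜ z) := fun _ _ _ => rfl
  set α := (Algebra.TensorProduct.assoc ℂ ℂ ℂ (SGAlg D.ρ) (SGAlg D.ρ) (SGAlg D.ρ)).toAlgHom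
    with hα
  set M := Algebra.TensorProduct.map (comulHom D B) (.id ℂ (SGAlg D.ρ)) with hM
  set N := Algebra.TensorProduct.map (.id ℂ (SGAlg D.ρ)) (comulHom D B) with hN
  let iL : SGAlg D.ρ ⊗[ℂ] SGAlg D.ρ →ₐ[ℂ] (SGAlg D.ρ ⊗[ℂ] SGAlg D.ρ) ⊗[ℂ] SGAlg D.ρ :=
    Algebra.TensorProduct.includeLeft
  let iR : SGAlg D.ρ ⊗[ℂ] SGAlg D.ρ →ₐ[ℂ] SGAlg D.ρ ⊗[ℂ] (SGAlg D.ρ ⊗[ℂ] SGAlg D.ρ) :=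
    Algebra.TensorProduct.includeRight
  have hL : ∀ s t : V ⊗[ℂ] V, Commute (M (bten D s)) (iL (bten D t)) := by
    intro s t
    induction s using TensorProduct.induction_on with
    | zero => simp
    | add x y hx hy => rw [map_add, map_add]; exact hx.add_left hy
    | tmul v w =>
      rw [bten_tmul, hM, Algebra.TensorProduct.map_tmul]
      change _ * (bten D t ⊗ₜ 1) = (bten D t ⊗ₜ 1) * _
      rw [Algebra.TensorProduct.tmul_mul_tmul, Algebra.TensorProduct.tmul_mul_tmul,
        (comul_vec_uu_commute D B t v).eq, mul_one, one_mul]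
  have hR : ∀ s t : V ⊗[ℂ] V, Commute (N (bten D s)) (iR (bten D t)) := by
    intro s t
    induction s using TensorProduct.induction_on with
    | zero => simp
    | add x y hx hy => rw [map_add, map_add]; exact hx.add_left hy
    | tmul v w =>
      rw [bten_tmul, hN, Algebra.TensorProduct.map_tmul]
      change _ * (1 ⊗ₜ bten D t) = (1 ⊗ₜ bten D t) * _
      rw [Algebra.TensorProduct.tmul_mul_tmul, Algebra.TensorProduct.tmul_mul_tmul,
        (comul_vec_commute D B t w).eq, mul_one, one_mul]
  have hT : ∀ t : V ⊗[ℂ] V, α (M (bten D t) + iL (bten D t)) = N (bten D t) + iR (bten D t) := by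
    intro t
    induction t using TensorProduct.induction_on with
    | zero => simp
    | add x y hx hy =>
      rw [map_add (bten D), map_add M, map_add iL, add_add_add_comm, map_add α, hx, hy,
        map_add N, map_add iR, add_add_add_comm]
    | tmul v w =>
      have e1 : iL (bten D (v ⊗ₜ w)) = ((vec D.ρ v * uu D) ⊗ₜ vec D.ρ w) ⊗ₜ 1 := by
        rw [bten_tmul]; rfl
      have e2 : iR (bten D (v ⊗ₜ w)) = 1 ⊗ₜ ((vec D.ρ v * uu D) ⊗ₜ vec D.ρ w) := by
        rw [bten_tmul]; rfl
      rw [e1, e2, bten_tmul, hM, hN, Algebra.TensorProduct.map_tmul,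
        Algebra.TensorProduct.map_tmul, comul_vec_uu, comul_vec, map_add,
        TensorProduct.add_tmul, TensorProduct.tmul_add, map_add, assoc_apply, assoc_apply,
        assoc_apply]
      simp only [AlgHom.id_apply]
      abel
  have hb := bten_nilpotent D B
  have nM := nilpotent_map (Y := (SGAlg D.ρ ⊗[ℂ] SGAlg D.ρ) ⊗[ℂ] SGAlg D.ρ) M hb
  have niL := nilpotent_map (Y := (SGAlg D.ρ ⊗[ℂ] SGAlg D.ρ) ⊗[ℂ] SGAlg D.ρ) iL hb
  have nN := nilpotent_map (Y := SGAlg D.ρ ⊗[ℂ] (SGAlg D.ρ ⊗[ℂ] SGAlg D.ρ)) N hb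
  have niR := nilpotent_map (Y := SGAlg D.ρ ⊗[ℂ] (SGAlg D.ρ ⊗[ℂ] SGAlg D.ρ)) iR hb
  have eM : ∀ {x}, IsNilpotent x → M (nilExp x) = nilExp (M x) := fun hx =>
    map_nilExp (Y := (SGAlg D.ρ ⊗[ℂ] SGAlg D.ρ) ⊗[ℂ] SGAlg D.ρ) M hx
  have eN : ∀ {x}, IsNilpotent x → N (nilExp x) = nilExp (N x) := fun hx =>
    map_nilExp (Y := SGAlg D.ρ ⊗[ℂ] (SGAlg D.ρ ⊗[ℂ] SGAlg D.ρ)) N hx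
  have eL : ∀ {x}, IsNilpotent x → iL (nilExp x) = nilExp (iL x) := fun hx =>
    map_nilExp (Y := (SGAlg D.ρ ⊗[ℂ] SGAlg D.ρ) ⊗[ℂ] SGAlg D.ρ) iL hx
  have eR : ∀ {x}, IsNilpotent x → iR (nilExp x) = nilExp (iR x) := fun hx =>
    map_nilExp (Y := SGAlg D.ρ ⊗[ℂ] (SGAlg D.ρ ⊗[ℂ] SGAlg D.ρ)) iR hx
  have eα : ∀ {x}, IsNilpotent x → α (nilExp x) = nilExp (α x) := fun hx =>
    map_nilExp (X := (SGAlg D.ρ ⊗[ℂ] SGAlg D.ρ) ⊗[ℂ] SGAlg D.ρ)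
      (Y := SGAlg D.ρ ⊗[ℂ] (SGAlg D.ρ ⊗[ℂ] SGAlg D.ρ)) α hx
  refine sgAlg_hom_ext (fun v => ?_) (fun g => ?_)
  · simp only [AlgHom.comp_apply]
    rw [comul_vec, map_add, map_add, map_add, hM, hN]
    simp only [Algebra.TensorProduct.map_tmul, comul_vec, comul_uu, map_one, AlgHom.id_apply,
      TensorProduct.add_tmul, TensorProduct.tmul_add, map_add, assoc_apply,
      Algebra.TensorProduct.one_def]
    abel
  · have key : comulHom D B (grp D.ρ g) =
        nilExp (-bten D B) * (grp D.ρ g ⊗ₜ grp D.ρ g) * nilExp (bten D B) := by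
      rw [comul_grp, conjHom_apply]; rfl
    have kM : M (grp D.ρ g ⊗ₜ grp D.ρ g) = nilExp (-iL (bten D B)) *
        ((grp D.ρ g ⊗ₜ grp D.ρ g) ⊗ₜ grp D.ρ g) * nilExp (iL (bten D B)) := by
      rw [← map_neg iL, ← eL hb, ← eL hb.neg, hM,
        Algebra.TensorProduct.map_tmul, key]
      change _ = (nilExp (-bten D B) ⊗ₜ[ℂ] (1 : SGAlg D.ρ)) *
        ((grp D.ρ g ⊗ₜ grp D.ρ g) ⊗ₜ grp D.ρ g) * (nilExp (bten D B) ⊗ₜ[ℂ] (1 : SGAlg D.ρ))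
      rw [Algebra.TensorProduct.tmul_mul_tmul, Algebra.TensorProduct.tmul_mul_tmul, one_mul,
        mul_one]
      rfl
    have kN : N (grp D.ρ g ⊗ₜ grp D.ρ g) = nilExp (-iR (bten D B)) *
        (grp D.ρ g ⊗ₜ (grp D.ρ g ⊗ₜ grp D.ρ g)) * nilExp (iR (bten D B)) := by
      rw [← map_neg iR, ← eR hb, ← eR hb.neg, hN,
        Algebra.TensorProduct.map_tmul, key]
      change _ = ((1 : SGAlg D.ρ) ⊗ₜ[ℂ] nilExp (-bten D B)) *
        (grp D.ρ g ⊗ₜ (grp D.ρ g ⊗ₜ grp D.ρ g)) * ((1 : SGAlg D.ρ) ⊗ₜ[ℂ] nilExp (bten D B))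
      rw [Algebra.TensorProduct.tmul_mul_tmul, Algebra.TensorProduct.tmul_mul_tmul, one_mul,
        mul_one]
      rfl
    have nL : IsNilpotent (M (bten D B) + iL (bten D B)) :=
      (hL B B).isNilpotent_add nM niL
    rw [AlgHom.comp_apply, AlgHom.comp_apply, AlgHom.comp_apply, key, map_mul M, map_mul M,
      map_mul N, map_mul N, kM, kN, eM hb, eM hb.neg, eN hb,
      eN hb.neg, map_neg M, map_neg N, conj_exp_aux _ nM niL (hL B B),
      conj_exp_aux _ nN niR (hR B B), map_mul α, map_mul α, eα nL,
      eα nL.neg, map_neg α, hT, assoc_apply]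

lemma counit_left (B : V ⊗[ℂ] V) :
    (Algebra.TensorProduct.map (counitHom D.ρ) (.id ℂ _)).comp (comulHom D B) =
      (Algebra.TensorProduct.lid ℂ (SGAlg D.ρ)).symm := by
  have hb : Algebra.TensorProduct.map (counitHom D.ρ) (.id ℂ _) (bten D B) = 0 := by
    induction B using TensorProduct.induction_on with
    | zero => simp
    | add x y hx hy => rw [map_add, map_add, hx, hy, add_zero]
    | tmul v w => rw [bten_tmul]; simp
  refine sgAlg_hom_ext (fun v => ?_) (fun g => ?_)
  · simp [comul_vec, uu]
  · have h1 : Algebra.TensorProduct.map (counitHom D.ρ) (.id ℂ _)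
        (twist D B : SGAlg D.ρ ⊗[ℂ] SGAlg D.ρ) = 1 := by
      refine (map_nilExp _ (bten_nilpotent D B)).trans ?_
      rw [hb, nilExp_zero]
    have h2 : Algebra.TensorProduct.map (counitHom D.ρ) (.id ℂ _)
        (↑(twist D B)⁻¹ : SGAlg D.ρ ⊗[ℂ] SGAlg D.ρ) = 1 := by
      refine (map_nilExp _ (bten_nilpotent D B).neg).trans ?_
      rw [map_neg, hb, neg_zero, nilExp_zero]
    rw [AlgHom.comp_apply, comul_grp, conjHom_apply, map_mul, map_mul, h1, h2]
    simp

lemma counit_right (B : V ⊗[ℂ] V) :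
    (Algebra.TensorProduct.map (.id ℂ _) (counitHom D.ρ)).comp (comulHom D B) =
      (Algebra.TensorProduct.rid ℂ ℂ (SGAlg D.ρ)).symm := by
  have hb : Algebra.TensorProduct.map (.id ℂ _) (counitHom D.ρ) (bten D B) = 0 := by
    induction B using TensorProduct.induction_on with
    | zero => simp
    | add x y hx hy => rw [map_add, map_add, hx, hy, add_zero]
    | tmul v w => rw [bten_tmul]; simp
  refine sgAlg_hom_ext (fun v => ?_) (fun g => ?_)
  · simp [comul_vec, uu]
  · have h1 : Algebra.TensorProduct.map (.id ℂ _) (counitHom D.ρ)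
        (twist D B : SGAlg D.ρ ⊗[ℂ] SGAlg D.ρ) = 1 := by
      refine (map_nilExp _ (bten_nilpotent D B)).trans ?_
      rw [hb, nilExp_zero]
    have h2 : Algebra.TensorProduct.map (.id ℂ _) (counitHom D.ρ)
        (↑(twist D B)⁻¹ : SGAlg D.ρ ⊗[ℂ] SGAlg D.ρ) = 1 := by
      refine (map_nilExp _ (bten_nilpotent D B).neg).trans ?_
      rw [map_neg, hb, neg_zero, nilExp_zero]
    rw [AlgHom.comp_apply, comul_grp, conjHom_apply, map_mul, map_mul, h1, h2]
    simp

/-- The bialgebra structure of `A(G, V, u, B)`. -/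
abbrev bialg (B : V ⊗[ℂ] V) : Bialgebra ℂ (SGAlg D.ρ) :=
  Bialgebra.ofAlgHom (comulHom D B) (counitHom D.ρ) (comul_coassoc D B) (counit_left D B)
    (counit_right D B)

end Boson

variable (V) in
/-- The space `S²V` of symmetric 2-tensors. -/
def symTensors : Submodule ℂ (V ⊗[ℂ] V) where
  carrier := {t | TensorProduct.comm ℂ V V t = t}
  zero_mem' := map_zero _
  add_mem' hs ht := by
    rw [Set.mem_ofPred_eq] at *
    rw [map_add, hs, ht]
  smul_mem' c t ht := by
    rw [Set.mem_ofPred_eq] at *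
    rw [map_smul, ht]

section Antipode
variable (D : SuperGroupDatum G V)

/-- The multiplication map on `V ⊗ V`. -/
def vmul : V ⊗[ℂ] V →ₗ[ℂ] SGAlg D.ρ :=
  LinearMap.mul' ℂ _ ∘ₗ TensorProduct.map (vec D.ρ) (vec D.ρ)

lemma vmul_symm (B : symTensors V) : vmul D B = 0 := by
  have h : ∀ t : V ⊗[ℂ] V, vmul D (TensorProduct.comm ℂ V V t) = - vmul D t := by
    intro t
    induction t using TensorProduct.induction_on with
    | zero => simp
    | add x y hx hy => rw [map_add, map_add, map_add, hx, hy, neg_add]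
    | tmul v w =>
      change vec D.ρ w * vec D.ρ v = -(vec D.ρ v * vec D.ρ w)
      exact vec_mul_swap _ _ _
  have h2 := h B
  rw [show TensorProduct.comm ℂ V V (B : V ⊗[ℂ] V) = B from B.2] at h2
  have h3 : (2 : ℂ) • vmul D (B : V ⊗[ℂ] V) = 0 := by
    rw [two_smul]; nth_rw 1 [h2]; simp
  simpa using h3

/-- `x ⊗ y ↦ S(x) y` -/
def mulL : SGAlg D.ρ ⊗[ℂ] SGAlg D.ρ →ₗ[ℂ] SGAlg D.ρ :=
  LinearMap.mul' ℂ _ ∘ₗ (antipodeLin D).rTensor _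

/-- `x ⊗ y ↦ x S(y)` -/
def mulR : SGAlg D.ρ ⊗[ℂ] SGAlg D.ρ →ₗ[ℂ] SGAlg D.ρ :=
  LinearMap.mul' ℂ _ ∘ₗ (antipodeLin D).lTensor _

lemma mulL_tmul (x y : SGAlg D.ρ) : mulL D (x ⊗ₜ y) = antipodeLin D x * y := rfl
lemma mulR_tmul (x y : SGAlg D.ρ) : mulR D (x ⊗ₜ y) = x * antipodeLin D y := rfl

lemma mulL_bten_mul (B : symTensors V) (t : SGAlg D.ρ ⊗[ℂ] SGAlg D.ρ) :
    mulL D (bten D B * t) = 0 := by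
  induction t using TensorProduct.induction_on with
  | zero => simp
  | add x y hx hy => rw [mul_add, map_add, hx, hy, add_zero]
  | tmul x y =>
    have h : ∀ s : V ⊗[ℂ] V, mulL D (bten D s * x ⊗ₜ y) =
        -(antipodeLin D x * vmul D s * y) := by
      intro s
      induction s using TensorProduct.induction_on with
      | zero => simp
      | add x y hx hy =>
        rw [map_add, add_mul, map_add, map_add, hx, hy, mul_add, add_mul, neg_add]
      | tmul v w =>
        rw [bten_tmul, Algebra.TensorProduct.tmul_mul_tmul, mulL_tmul, antipode_mul, antipode_mul,
          antipode_vec, antipode_uu, mul_neg, ← mul_assoc (uu D), uu_mul_uu, one_mul]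
        change _ = -(antipodeLin D x * (vec D.ρ v * vec D.ρ w) * y)
        simp only [mul_assoc, neg_mul, mul_neg]
    rw [h, vmul_symm]; simp

lemma mulR_mul_bten (B : symTensors V) (t : SGAlg D.ρ ⊗[ℂ] SGAlg D.ρ) :
    mulR D (t * bten D B) = 0 := by
  induction t using TensorProduct.induction_on with
  | zero => simp
  | add x y hx hy => rw [add_mul, map_add, hx, hy, add_zero]
  | tmul x y =>
    have h : ∀ s : V ⊗[ℂ] V, mulR D (x ⊗ₜ y * bten D s) =
        -(x * vmul D s * antipodeLin D y) := by
      intro s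
      induction s using TensorProduct.induction_on with
      | zero => simp
      | add x y hx hy =>
        rw [map_add, mul_add, map_add, map_add, hx, hy, mul_add, add_mul, neg_add]
      | tmul v w =>
        rw [bten_tmul, Algebra.TensorProduct.tmul_mul_tmul, mulR_tmul, antipode_mul,
          antipode_vec]
        change _ = -(x * (vec D.ρ v * vec D.ρ w) * antipodeLin D y)
        have e : uu D * (uu D * vec D.ρ w) = vec D.ρ w := by
          rw [← mul_assoc, uu_mul_uu, one_mul]
        simp only [mul_assoc, neg_mul, mul_neg]
        rw [← mul_assoc (uu D) (vec D.ρ w), ← mul_assoc (uu D), e]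
    rw [h, vmul_symm]; simp

lemma mulL_exp_mul (B : symTensors V) (t : SGAlg D.ρ ⊗[ℂ] SGAlg D.ρ) :
    mulL D (nilExp (bten D B) * t) = mulL D t := by
  obtain ⟨y, hy, -⟩ := nilExp_expand (bten_nilpotent D (B : V ⊗[ℂ] V))
  rw [hy, add_mul, map_add, one_mul, mul_assoc, mulL_bten_mul, add_zero]

lemma mulR_mul_exp (B : symTensors V) (t : SGAlg D.ρ ⊗[ℂ] SGAlg D.ρ) :
    mulR D (t * nilExp (bten D B)) = mulR D t := by
  obtain ⟨y, -, hy⟩ := nilExp_expand (bten_nilpotent D (B : V ⊗[ℂ] V))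
  rw [hy, mul_add, map_add, mul_one, ← mul_assoc, mulR_mul_bten, add_zero]

lemma mulL_comul (B : symTensors V) (a : SGAlg D.ρ) : ∀ t : SGAlg D.ρ ⊗[ℂ] SGAlg D.ρ,
    mulL D (comulHom D B a * t) = counitHom D.ρ a • mulL D t := by
  induction a using sgAlg_induction with
  | hv v =>
    intro t
    rw [comul_vec, counitHom_vec, zero_smul]
    induction t using TensorProduct.induction_on with
    | zero => simp
    | add x y hx hy => rw [mul_add, map_add, hx, hy, add_zero]
    | tmul x y =>
      rw [add_mul, map_add, Algebra.TensorProduct.tmul_mul_tmul,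
        Algebra.TensorProduct.tmul_mul_tmul, mulL_tmul, mulL_tmul, antipode_mul, antipode_mul,
        antipode_vec, antipode_uu]
      simp [mul_assoc]
  | hg g =>
    intro t
    have h : ∀ t, mulL D ((grp D.ρ g ⊗ₜ grp D.ρ g) * t) = mulL D t := by
      intro t
      induction t using TensorProduct.induction_on with
      | zero => simp
      | add x y hx hy => rw [mul_add, map_add, hx, hy, map_add]
      | tmul x y =>
        rw [Algebra.TensorProduct.tmul_mul_tmul, mulL_tmul, mulL_tmul, antipode_mul, antipode_grp,
          mul_assoc, ← mul_assoc (grp D.ρ g⁻¹), ← map_mul, inv_mul_cancel, map_one, one_mul]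
    rw [comul_grp, counitHom_grp, one_smul, conjHom_apply, mul_assoc, mul_assoc]
    change mulL D (nilExp (-bten D B) * _) = _
    rw [← map_neg, ← Submodule.coe_neg, mulL_exp_mul, h]
    exact mulL_exp_mul D B t
  | hc c =>
    intro t
    simp [Algebra.algebraMap_eq_smul_one]
  | hadd x y hx hy => intro t; rw [map_add, add_mul, map_add, hx, hy, map_add, add_smul]
  | hmul x y hx hy => intro t; rw [map_mul (comulHom D _), mul_assoc, hx, hy, map_mul, mul_smul]

lemma mulR_comul (B : symTensors V) (a : SGAlg D.ρ) : ∀ t : SGAlg D.ρ ⊗[ℂ] SGAlg D.ρ,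
    mulR D (t * comulHom D B a) = counitHom D.ρ a • mulR D t := by
  induction a using sgAlg_induction with
  | hv v =>
    intro t
    rw [comul_vec, counitHom_vec, zero_smul]
    induction t using TensorProduct.induction_on with
    | zero => simp
    | add x y hx hy => rw [add_mul, map_add, hx, hy, add_zero]
    | tmul x y =>
      rw [mul_add, map_add, Algebra.TensorProduct.tmul_mul_tmul,
        Algebra.TensorProduct.tmul_mul_tmul, mulR_tmul, mulR_tmul, antipode_mul, antipode_mul,
        antipode_vec, antipode_one]
      have e : uu D * (uu D * vec D.ρ v) = vec D.ρ v := by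
        rw [← mul_assoc, uu_mul_uu, one_mul]
      simp only [neg_mul, mul_neg, mul_assoc, one_mul]
      rw [← mul_assoc (uu D) (vec D.ρ v), ← mul_assoc (uu D), e, add_neg_cancel]
  | hg g =>
    intro t
    have h : ∀ t, mulR D (t * (grp D.ρ g ⊗ₜ grp D.ρ g)) = mulR D t := by
      intro t
      induction t using TensorProduct.induction_on with
      | zero => simp
      | add x y hx hy => rw [add_mul, map_add, hx, hy, map_add]
      | tmul x y =>
        rw [Algebra.TensorProduct.tmul_mul_tmul, mulR_tmul, mulR_tmul, antipode_mul, antipode_grp,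
          mul_assoc, ← mul_assoc (grp D.ρ g), ← map_mul, mul_inv_cancel, map_one, one_mul]
    rw [comul_grp, counitHom_grp, one_smul, conjHom_apply, ← mul_assoc, ← mul_assoc]
    refine (mulR_mul_exp D B _).trans ?_
    rw [h]
    change mulR D (t * nilExp (-bten D B)) = _
    rw [← map_neg, ← Submodule.coe_neg, mulR_mul_exp]
  | hc c =>
    intro t
    simp [Algebra.algebraMap_eq_smul_one]
  | hadd x y hx hy => intro t; rw [map_add, mul_add, map_add, hx, hy, map_add, add_smul]
  | hmul x y hx hy =>
    intro t; rw [map_mul (comulHom D _), ← mul_assoc, hy, hx, map_mul, mul_comm, mul_smul]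

/-- The Hopf algebra structure of `A(G, V, u, B)`. -/
abbrev hopf (B : symTensors V) : HopfAlgebra ℂ (SGAlg D.ρ) where
  toBialgebra := bialg D B
  antipode := antipodeLin D
  mul_antipode_rTensor_comul := LinearMap.ext fun a => by
    have h := mulL_comul D B a 1
    rw [mul_one, Algebra.TensorProduct.one_def, mulL_tmul, antipode_one, mul_one] at h
    exact h.trans (Algebra.algebraMap_eq_smul_one _).symm
  mul_antipode_lTensor_comul := LinearMap.ext fun a => by
    have h := mulR_comul D B a 1
    rw [one_mul, Algebra.TensorProduct.one_def, mulR_tmul, antipode_one, mul_one] at h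
    exact h.trans (Algebra.algebraMap_eq_smul_one _).symm

end Antipode

/-- The Hopf algebra `A(G, V, u, B)`: as an algebra it is `ℂ[G ⋉ V] = ℂ[G] ⋉ ΛV`, and its coproduct
is that of the twisted Hopf superalgebra `ℂ[G ⋉ V]^J`, `J = e^B`, modified by `u`. -/
def HopfA (D : SuperGroupDatum G V) (_B : symTensors V) : Type _ := SGAlg D.ρ

instance (D : SuperGroupDatum G V) (B : symTensors V) : Ring (HopfA D B) :=
  inferInstanceAs (Ring (SGAlg D.ρ))

instance (D : SuperGroupDatum G V) (B : symTensors V) : HopfAlgebra ℂ (HopfA D B) :=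
  hopf D B

/-- A subcoalgebra of a coalgebra `C`: a subspace `E` with `Δ(E) ⊆ E ⊗ E`. -/
def IsSubcoalgebra {R C : Type*} [CommSemiring R] [AddCommMonoid C] [Module R C] [Coalgebra R C]
    (E : Submodule R C) : Prop :=
  ∀ x ∈ E, Coalgebra.comul (R := R) x ∈ LinearMap.range (TensorProduct.map E.subtype E.subtype)

/-- A simple subcoalgebra: a nonzero subcoalgebra whose only subcoalgebras are `0` and itself. -/
def IsSimpleSubcoalgebra {R C : Type*} [CommSemiring R] [AddCommMonoid C] [Module R C]
    [Coalgebra R C] (E : Submodule R C) : Prop :=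
  IsSubcoalgebra E ∧ E ≠ ⊥ ∧ ∀ E' ≤ E, IsSubcoalgebra E' → E' = ⊥ ∨ E' = E

/-- A coalgebra is pointed if all its simple subcoalgebras are one-dimensional. -/
def IsPointedCoalgebra (R C : Type*) [CommSemiring R] [AddCommMonoid C] [Module R C]
    [Coalgebra R C] : Prop :=
  ∀ E : Submodule R C, IsSimpleSubcoalgebra E → Module.finrank R E = 1

end SuperHopf
end

/-! Let b(t) be the image of t ∈ V ⊗ V in the ordinary tensor square, and let gB be the transform of
B by g. Moving g ⊗ g to the right past e^b(B) gives Δ(g) = e^(-b(B)) e^(b(gB)) (g ⊗ g)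
(`comul_grp_eq`); both implications rest on this formula.

If B is invariant, every g ∈ G is group-like and the coproduct no longer depends on B, so the
identity is an isomorphism with the case B = 0. Pointedness comes from the filtration by degree in
V: applying a functional that vanishes on ℂ[G] to the right factor of Δ(x) lowers the degree of x. A
nonzero element of least degree in a subcoalgebra therefore lies in ℂ[G]; its components along G
stay in the subcoalgebra, which thus contains some g (`exists_grp_mem_of_isSubcoalgebra`).

Conversely, let K be the subalgebra generated by V and u. By the formula, Kg is a subcoalgebra, so
in the pointed case it contains a group-like x. Killing V in one factor of the coproduct gives
coactions of ℂ[G] on either side, and these force x = ah with a ∈ ΛV even; also h is g or ug,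
because x ∈ Kg. As x is even, J⁻¹Δ(x)J = x ⊗ x already holds in the super tensor square, Δ being the
untwisted coproduct. The super flip fixes Δ(x) and x ⊗ x, but it sends the symmetric tensor B to -B,
since vectors are odd; hence JΔ(x)J⁻¹ = x ⊗ x as well, and x ⊗ x commutes with J² = e^(2B). Since a
is even it commutes with V, so conjugation by x ⊗ x acts on V ⊗ V as h does. Thus e^(2hB) = e^(2B),
and injectivity of the exponential gives hB = B (`tprod_apply_eq_of_comul`). Finally u acts
trivially on V ⊗ V, so gB = B.

The second equivalence follows because pointedness is invariant under coalgebra isomorphism and 0 is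
an invariant tensor. -/

noncomputable section
namespace SuperHopf

/-! ### Injectivity of the exponential on commuting nilpotents. -/

section Exponential
variable {X : Type*} [Ring X] [Algebra ℂ X]

/-- The difference e^z - 1 equals z(1 + zs) with s a polynomial in z, and 1 + zs is a unit because
zs is nilpotent. -/
lemma eq_zero_of_nilExp_eq_one {z : X} (hz : IsNilpotent z) (h : nilExp z = 1) : z = 0 := by
  let _ : Module ℚ X := Module.compHom X (algebraMap ℚ ℂ)
  obtain ⟨n, hn⟩ := hz
  -- The exponent n + 2 lets the constant and the linear term be split off the exponential sum,
  -- leaving n terms.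
  have hn' : z ^ (n + 2) = 0 := by rw [pow_add, hn, zero_mul]
  rw [nilExp_eq, IsNilpotent.exp_eq_sum hn', Finset.sum_range_succ', Finset.sum_range_succ'] at h
  set s : X := ∑ k ∈ Finset.range n, (((k + 1 + 1).factorial : ℚ)⁻¹) • z ^ k with hs
  have hcomm : Commute z s := Commute.sum_right _ _ _ fun k _ => by
    have := ((Commute.refl z).pow_right k).smul_right (((k + 1 + 1).factorial : ℂ)⁻¹)
    rwa [show (((k + 1 + 1).factorial : ℂ)⁻¹) • z ^ k =
      (((k + 1 + 1).factorial : ℚ)⁻¹) • z ^ k by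
        rw [← Rat.cast_smul_eq_qsmul ℂ]; push_cast; rfl] at this
  have e : z * (z * s + 1) = 0 := by
    have e2 : z * (z * s) =
        ∑ k ∈ Finset.range n, (((k + 1 + 1).factorial : ℚ)⁻¹) • z ^ (k + 1 + 1) := by
      rw [hs, Finset.mul_sum, Finset.mul_sum]
      refine Finset.sum_congr rfl fun k _ => ?_
      rw [← Rat.cast_smul_eq_qsmul ℂ, ← Rat.cast_smul_eq_qsmul ℂ, mul_smul_comm, mul_smul_comm,
        ← pow_succ', ← pow_succ']
    rw [mul_add, e2, mul_one]
    simpa using h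
  have hu : IsUnit (z * s + 1) := (hcomm.isNilpotent_mul_right ⟨n, hn⟩).isUnit_add_one
  exact (hu.mul_left_eq_zero).mp e

/-- Commutation gives e^(x - y) = e^x e^(-y) = 1, so x - y vanishes. -/
lemma nilExp_injective {x y : X} (h : Commute x y) (hx : IsNilpotent x) (hy : IsNilpotent y)
    (he : nilExp x = nilExp y) : x = y := by
  have hn : IsNilpotent (x + -y) := (h.neg_right).isNilpotent_add hx hy.neg
  refine add_neg_eq_zero.mp (eq_zero_of_nilExp_eq_one hn ?_)
  rw [nilExp_add h.neg_right hx hy.neg, he, nilExp_mul_neg hy]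

end Exponential

/-! ### Slice maps on a tensor square. -/

section Slices
variable {R A : Type*} [CommRing R] [AddCommGroup A] [Module R A]

/-- The slice map `x ⊗ y ↦ f(y) x`. -/
def sliceRight (f : A →ₗ[R] R) : A ⊗[R] A →ₗ[R] A :=
  (TensorProduct.rid R A).toLinearMap ∘ₗ f.lTensor A

/-- The slice map `x ⊗ y ↦ f(x) y`. -/
def sliceLeft (f : A →ₗ[R] R) : A ⊗[R] A →ₗ[R] A :=
  (TensorProduct.lid R A).toLinearMap ∘ₗ f.rTensor A

@[simp] lemma sliceRight_tmul (f : A →ₗ[R] R) (x y : A) : sliceRight f (x ⊗ₜ y) = f y • x := rfl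

@[simp] lemma sliceLeft_tmul (f : A →ₗ[R] R) (x y : A) : sliceLeft f (x ⊗ₜ y) = f x • y := rfl

/-- This is how the subcoalgebra condition is exploited: a subcoalgebra is stable under all slices
of its coproduct. -/
lemma sliceRight_mem (f : A →ₗ[R] R) {M N : Submodule R A} {t : A ⊗[R] A}
    (ht : t ∈ LinearMap.range (TensorProduct.map M.subtype N.subtype)) : sliceRight f t ∈ M := by
  obtain ⟨s, rfl⟩ := ht
  induction s using TensorProduct.induction_on with
  | zero => simp
  | add x y hx hy => rw [map_add, map_add]; exact add_mem hx hy
  | tmul x y => exact M.smul_mem _ x.2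

lemma sliceRight_comp (f : A →ₗ[R] R) (p : A →ₗ[R] A) (t : A ⊗[R] A) :
    sliceRight (f ∘ₗ p) t = sliceRight f (TensorProduct.map LinearMap.id p t) := by
  induction t using TensorProduct.induction_on with
  | zero => simp
  | add x y hx hy => simp only [map_add, hx, hy]
  | tmul x y => simp

end Slices

variable {G V : Type*} [Group G] [AddCommGroup V] [Module ℂ V]

/-! ### The projection onto the group algebra, and injectivity of the structure maps. -/

section Projections
variable (ρ : Representation ℂ G V)

/-- The projection of `ℂ[G ⋉ V]` to `ℂ[G]` that kills `V`. -/
def grpProj : SGAlg ρ →ₐ[ℂ] SGAlg ρ := sgLift 0 (by simp) (grp ρ) (by simp)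

@[simp] lemma grpProj_vec (v : V) : grpProj ρ (vec ρ v) = 0 := sgLift_vec _ _ _ _ _ v

@[simp] lemma grpProj_grp (g : G) : grpProj ρ (grp ρ g) = grp ρ g := sgLift_grp _ _ _ _ _ g

/-- The scalar part of an element of `ΛV`. -/
def lamScalar : Lam ρ →ₐ[ℂ] ℂ := (ExteriorAlgebra.algebraMapInv : ExteriorAlgebra ℂ V →ₐ[ℂ] ℂ)

lemma grpProj_incl (a : Lam ρ) : grpProj ρ (incl ρ a) = algebraMap ℂ _ (lamScalar ρ a) := by
  have h : (grpProj ρ).comp (incl ρ) = (Algebra.ofId ℂ (SGAlg ρ)).comp (lamScalar ρ) := by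
    refine ExteriorAlgebra.hom_ext (LinearMap.ext fun v => ?_)
    change grpProj ρ (vec ρ v) = algebraMap ℂ _ (lamScalar ρ (ExteriorAlgebra.ι ℂ v))
    have hv : lamScalar ρ (ExteriorAlgebra.ι ℂ v) = 0 :=
      ExteriorAlgebra.lift_ι_apply ℂ (0 : V →ₗ[ℂ] ℂ) (by simp) v
    rw [grpProj_vec, hv, map_zero]
  exact DFunLike.congr_fun h a

/-- The coefficient of `k ∈ G` in the projection to `ℂ[G]` of an element of `ℂ[G ⋉ V]`. -/
def grpCoeff (k : G) : SGAlg ρ →ₗ[ℂ] ℂ :=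
  (lamScalar ρ).toLinearMap ∘ₗ Finsupp.lapply k ∘ₗ
    (SkewMonoidAlgebra.coeffLinearEquiv (S := ℂ)).toLinearMap

lemma grpCoeff_apply (k : G) (x : SGAlg ρ) : grpCoeff ρ k x = lamScalar ρ (x.coeff k) := rfl

lemma grpCoeff_grp [DecidableEq G] (k g : G) : grpCoeff ρ k (grp ρ g) = if g = k then 1 else 0 := by
  rw [grpCoeff_apply]
  change lamScalar ρ ((SkewMonoidAlgebra.single g 1).coeff k) = _
  rw [SkewMonoidAlgebra.coeff_single_apply]
  split_ifs <;> simp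

lemma incl_injective : Function.Injective (incl ρ) := fun a b h => by
  have := congrArg (fun x : SGAlg ρ => x.coeff 1) h
  change (SkewMonoidAlgebra.single (1 : G) a).coeff 1 = (SkewMonoidAlgebra.single 1 b).coeff 1 at this
  simpa using this

lemma vec_injective : Function.Injective (vec ρ) :=
  (incl_injective ρ).comp (ExteriorAlgebra.ι_leftInverse (R := ℂ) (M := V)).injective

/-- Over a field, the tensor product of injective maps is injective. This allows an identity in V ⊗
V to be checked in the super tensor square. -/
lemma tens_injective : Function.Injective (tens ρ) := by
  refine (GradedTensorProduct.of ℂ (parity ρ) (parity ρ)).injective.comp ?_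
  exact TensorProduct.map_injective_of_flat_flat _ _ (vec_injective ρ) (vec_injective ρ)

lemma grp_isUnit (g : G) : IsUnit (grp ρ g) := (Group.isUnit g).map (grp ρ)

lemma grp_ne_zero (g : G) : grp ρ g ≠ 0 := fun h => by
  classical
  have := grpCoeff_grp ρ g g
  simp [h] at this

end Projections

/-! ### The two coactions of ℂ[G] obtained by killing V in one tensor factor. -/

section Coactions
variable (D : SuperGroupDatum G V) (B : V ⊗[ℂ] V)

lemma map_grpProj_right_bten :
    Algebra.TensorProduct.map (.id ℂ _) (grpProj D.ρ) (bten D B) = 0 := by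
  induction B using TensorProduct.induction_on with
  | zero => simp
  | add x y hx hy => rw [map_add, map_add, hx, hy, add_zero]
  | tmul v w => rw [bten_tmul]; simp

lemma map_grpProj_left_bten :
    Algebra.TensorProduct.map (grpProj D.ρ) (.id ℂ _) (bten D B) = 0 := by
  induction B using TensorProduct.induction_on with
  | zero => simp
  | add x y hx hy => rw [map_add, map_add, hx, hy, add_zero]
  | tmul v w => rw [bten_tmul]; simp

/-- A homomorphism that kills b sends e^b and e^(-b) to 1, so it does not see the twist. -/
lemma map_comul_grp {Y : Type*} [Ring Y] [Algebra ℂ Y]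
    (f : SGAlg D.ρ ⊗[ℂ] SGAlg D.ρ →ₐ[ℂ] Y) (hf : f (bten D B) = 0) (g : G) :
    f (comulHom D B (grp D.ρ g)) = f (grp D.ρ g ⊗ₜ grp D.ρ g) := by
  have h1 : f (twist D B : SGAlg D.ρ ⊗[ℂ] SGAlg D.ρ) = 1 := by
    refine (map_nilExp f (bten_nilpotent D B)).trans ?_
    rw [hf, nilExp_zero]
  have h2 : f (↑(twist D B)⁻¹ : SGAlg D.ρ ⊗[ℂ] SGAlg D.ρ) = 1 := by
    refine (map_nilExp f (bten_nilpotent D B).neg).trans ?_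
    rw [map_neg, hf, neg_zero, nilExp_zero]
  rw [comul_grp, conjHom_apply, map_mul, map_mul, h1, h2, one_mul, mul_one]

/-- The right coaction is the grading by G, whatever B is: both sides are multiplicative in a, so
vectors suffice. -/
lemma grpProj_right_comul (a : Lam D.ρ) (g : G) :
    Algebra.TensorProduct.map (.id ℂ _) (grpProj D.ρ) (comulHom D B (incl D.ρ a * grp D.ρ g)) =
      (incl D.ρ a * grp D.ρ g) ⊗ₜ grp D.ρ g := by
  have h : ((Algebra.TensorProduct.map (.id ℂ _) (grpProj D.ρ)).comp (comulHom D B)).comp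
      (incl D.ρ) = (Algebra.TensorProduct.includeLeft : SGAlg D.ρ →ₐ[ℂ] _).comp (incl D.ρ) := by
    refine ExteriorAlgebra.hom_ext (LinearMap.ext fun v => ?_)
    change Algebra.TensorProduct.map _ _ (comulHom D B (vec D.ρ v)) = vec D.ρ v ⊗ₜ 1
    simp [comul_vec]
  have h' : Algebra.TensorProduct.map (.id ℂ _) (grpProj D.ρ) (comulHom D B (incl D.ρ a)) =
    incl D.ρ a ⊗ₜ 1 := DFunLike.congr_fun h a
  rw [map_mul, map_mul, h', map_comul_grp D B _ (map_grpProj_right_bten D B)]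
  simp

/-- The left coaction also records parity: with a = a₀ + a₁, the right-hand side is h ⊗ a₀h + uh ⊗
a₁h for h = g. This detects odd parts. -/
lemma grpProj_left_comul (a : Lam D.ρ) (g : G) :
    Algebra.TensorProduct.map (grpProj D.ρ) (.id ℂ _) (comulHom D B (incl D.ρ a * grp D.ρ g)) =
      bosonRight D (incl D.ρ a) * grp D.ρ g ⊗ₜ grp D.ρ g := by
  have h : ((Algebra.TensorProduct.map (grpProj D.ρ) (.id ℂ _)).comp (comulHom D B)).comp
      (incl D.ρ) = (bosonRight D).comp (incl D.ρ) := by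
    refine ExteriorAlgebra.hom_ext (LinearMap.ext fun v => ?_)
    change Algebra.TensorProduct.map _ _ (comulHom D B (vec D.ρ v)) = bosonRight D (vec D.ρ v)
    have h1 : uu D ^ (1 : ZMod 2).val = uu D := pow_one _
    rw [bosonRight_apply D (vec_mem v), h1, comul_vec]
    simp [uu]
  have h' : Algebra.TensorProduct.map (grpProj D.ρ) (.id ℂ _) (comulHom D B (incl D.ρ a)) =
    bosonRight D (incl D.ρ a) := DFunLike.congr_fun h a
  rw [map_mul, map_mul, h', map_comul_grp D B _ (map_grpProj_left_bten D B)]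
  simp

/-- The component of x along k is a slice of its coproduct, so subcoalgebras are graded by G. -/
lemma sliceRight_comul (k : G) (x : SGAlg D.ρ) :
    sliceRight (grpCoeff D.ρ k ∘ₗ (grpProj D.ρ).toLinearMap) (comulHom D B x) =
      SkewMonoidAlgebra.single k (x.coeff k) := by
  classical
  rw [sliceRight_comp]
  change sliceRight _ (Algebra.TensorProduct.map (.id ℂ _) (grpProj D.ρ) (comulHom D B x)) = _
  induction x using SkewMonoidAlgebra.induction_on with
  | zero => simp
  | add x y hx hy =>
    rw [map_add, map_add, map_add, hx, hy, SkewMonoidAlgebra.coeff_add, Finsupp.add_apply,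
      SkewMonoidAlgebra.single_add]
  | single g a =>
    rw [← incl_mul_grp, grpProj_right_comul, sliceRight_tmul, grpCoeff_grp, incl_mul_grp,
      SkewMonoidAlgebra.coeff_single_apply]
    split_ifs with h
    · rw [h, one_smul]
    · simp

end Coactions

/-! ### Super-cocommutativity of the untwisted coproduct. -/

section SuperSymmetry
variable (ρ : Representation ℂ G V)

/-- The super flip `a ⊗ b ↦ (-1)^(|a||b|) b ⊗ a`. -/
def superFlip : SGAlg2 ρ →ₐ[ℂ] SGAlg2 ρ :=
  (GradedTensorProduct.comm (R := ℂ) (parity ρ) (parity ρ)).toAlgHom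

variable {ρ}

lemma superFlip_tmul {i j : ZMod 2} {a b : SGAlg ρ} (ha : a ∈ parity ρ i) (hb : b ∈ parity ρ j)
    (h : j * i = 0) : superFlip ρ (a ᵍ⊗ₜ[ℂ] b) = b ᵍ⊗ₜ[ℂ] a := by
  refine (GradedTensorProduct.comm_coe_tmul_coe (R := ℂ) (parity ρ) (parity ρ)
    (⟨a, ha⟩ : parity ρ i) (⟨b, hb⟩ : parity ρ j)).trans ?_
  rw [h, uzpow_zero, one_smul]

lemma superFlip_tmul_odd {a b : SGAlg ρ} (ha : a ∈ parity ρ 1) (hb : b ∈ parity ρ 1) :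
    superFlip ρ (a ᵍ⊗ₜ[ℂ] b) = -(b ᵍ⊗ₜ[ℂ] a) := by
  refine (GradedTensorProduct.comm_coe_tmul_coe (R := ℂ) (parity ρ) (parity ρ)
    (⟨a, ha⟩ : parity ρ 1) (⟨b, hb⟩ : parity ρ 1)).trans ?_
  rw [mul_one, uzpow_one, Units.neg_smul, one_smul]

/-- Group-like even generators and primitive odd generators both have flip-invariant coproducts. -/
lemma superFlip_superComul (x : SGAlg ρ) : superFlip ρ (superComul ρ x) = superComul ρ x := by
  have h : (superFlip ρ).comp (superComul ρ) = superComul ρ := by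
    refine sgAlg_hom_ext (fun v => ?_) (fun g => ?_)
    · rw [AlgHom.comp_apply, superComul_vec, map_add,
        superFlip_tmul (vec_mem v) one_mem' (zero_mul _),
        superFlip_tmul one_mem' (vec_mem v) (mul_zero _), add_comm]
    · rw [AlgHom.comp_apply, superComul_grp, superFlip_tmul (grp_mem g) (grp_mem g) (zero_mul _)]
  exact DFunLike.congr_fun h x

/-- The sign is that of two odd vectors passing each other. For symmetric B the flip therefore
exchanges J and J⁻¹. -/
lemma superFlip_tens (t : V ⊗[ℂ] V) :
    superFlip ρ (tens ρ t) = -tens ρ (TensorProduct.comm ℂ V V t) := by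
  induction t using TensorProduct.induction_on with
  | zero => simp
  | add x y hx hy => rw [map_add, map_add, map_add, map_add, hx, hy, neg_add]
  | tmul v w =>
    rw [tens_tmul, superFlip_tmul_odd (vec_mem v) (vec_mem w)]
    rfl

end SuperSymmetry

/-! ### Equivariance of the embedding of V ⊗ V. -/

section Evenness
variable {ρ : Representation ℂ G V}

lemma grp_tmul_mul_tens (h : G) (t : V ⊗[ℂ] V) :
    (grp ρ h ᵍ⊗ₜ[ℂ] grp ρ h : SGAlg2 ρ) * tens ρ t =
      tens ρ (ρ.tprod ρ h t) * (grp ρ h ᵍ⊗ₜ[ℂ] grp ρ h) := by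
  induction t using TensorProduct.induction_on with
  | zero => simp
  | add x y hx hy => simp only [map_add, mul_add, add_mul, hx, hy]
  | tmul v w =>
    rw [Representation.tprod_apply, TensorProduct.map_tmul, tens_tmul, tens_tmul,
      st_mul _ _ (grp_mem h) (vec_mem v) (zero_mul _),
      st_mul _ _ (vec_mem _) (grp_mem h) (mul_zero _), grp_mul_vec, grp_mul_vec]

end Evenness

/-! ### Group-like elements and the invariance they impose on B. -/

section GroupLike
variable {D : SuperGroupDatum G V}

/-- This is the sign rule of ΛV: u acts on ΛV as the parity involution, being -1 on V. In particular
even elements commute with V. -/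
lemma vec_mul_incl (v : V) (a : Lam D.ρ) :
    vec D.ρ v * incl D.ρ a = incl D.ρ (D.u • a) * vec D.ρ v := by
  let C : Lam D.ρ → Prop := fun a => vec D.ρ v * incl D.ρ a = incl D.ρ (D.u • a) * vec D.ρ v
  have hc : ∀ c : ℂ, C (algebraMap ℂ (Lam D.ρ) c) := by
    intro c
    change _ = _
    rw [Algebra.algebraMap_eq_smul_one, smul_comm, smul_one]
    simp
  have hι : ∀ w : V, C (ExteriorAlgebra.ι ℂ w : ExteriorAlgebra ℂ V) := by
    intro w
    let w' : Lam D.ρ := ExteriorAlgebra.ι ℂ w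
    have e : D.u • w' = -w' := by
      rw [Lam.smul_def]
      refine (ExteriorAlgebra.map_apply_ι _ w).trans ?_
      rw [D.u_act, map_neg]
      rfl
    change _ = incl D.ρ (D.u • w') * _
    rw [e, map_neg]
    change vec D.ρ v * vec D.ρ w = -vec D.ρ w * vec D.ρ v
    rw [vec_mul_swap, neg_mul]
  have hmul : ∀ a b : Lam D.ρ, C a → C b → C (a * b) := by
    intro a b ha hb
    change _ = _ at ha hb ⊢
    rw [smul_mul', map_mul, map_mul, ← mul_assoc, ha, mul_assoc, hb, mul_assoc]
  have hadd : ∀ a b : Lam D.ρ, C a → C b → C (a + b) := by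
    intro a b ha hb
    change _ = _ at ha hb ⊢
    rw [smul_add, map_add, map_add, mul_add, add_mul, ha, hb]
  exact ExteriorAlgebra.induction (C := C) hc hι hmul hadd a

lemma mem_lamParity_of_single {i : ZMod 2} {a : Lam D.ρ} {g : G}
    (h : SkewMonoidAlgebra.single g a ∈ parity D.ρ i) : a ∈ lamParity D.ρ i := by
  classical
  have := h g
  rwa [SkewMonoidAlgebra.coeff_single_apply, if_pos rfl] at this

lemma commute_vec_incl {a : Lam D.ρ} (ha : a ∈ lamParity D.ρ 0) (v : V) :
    Commute (vec D.ρ v) (incl D.ρ a) := by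
  have e : D.u • a = a := by rw [uu_act]; exact CliffordAlgebra.involute_eq_of_mem_even ha
  rw [commute_iff_eq, vec_mul_incl, e]

/-- Since u² = 1, the map a ⊗ b ↦ a u^|b| ⊗ b is undone by applying the same formula again. -/
lemma bosonize_injective : Function.Injective (bosonize D) := by
  let T : SGAlg D.ρ ⊗[ℂ] SGAlg D.ρ →ₗ[ℂ] SGAlg D.ρ ⊗[ℂ] SGAlg D.ρ :=
    ∑ i : ZMod 2, TensorProduct.map (LinearMap.mulRight ℂ (uu D ^ i.val)) (parityProj i)
  have hT : ∀ (i : ZMod 2) (a : SGAlg D.ρ) {b : SGAlg D.ρ}, b ∈ parity D.ρ i →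
      T (a ⊗ₜ b) = (a * uu D ^ i.val) ⊗ₜ b := by
    intro i a b hb
    simp only [T, LinearMap.sum_apply, TensorProduct.map_tmul, parityProj_of_mem hb,
      LinearMap.mulRight_apply]
    rw [Finset.sum_eq_single i]
    · simp
    · intro j _ hj; simp [hj.symm]
    · simp
  have hsq : ∀ i : ZMod 2, uu D ^ i.val * uu D ^ i.val = 1 := by
    intro i
    rw [← (Commute.refl (uu D)).mul_pow, uu_mul_uu, one_pow]
  have hTT : ∀ x : SGAlg2 D.ρ,
      T (bosonize D x) = (GradedTensorProduct.of ℂ (parity D.ρ) (parity D.ρ)).symm x := by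
    intro x
    have : T ∘ₗ (bosonize D).toLinearMap ∘ₗ
        (GradedTensorProduct.of ℂ (parity D.ρ) (parity D.ρ)).toLinearMap = LinearMap.id := by
      refine TensorProduct.ext' fun a b => ?_
      change T (bosonize D (a ᵍ⊗ₜ[ℂ] b)) = a ⊗ₜ b
      rw [← parityProj_sum b]
      simp only [GradedTensorProduct.tmul, TensorProduct.tmul_sum, map_sum]
      refine Finset.sum_congr rfl fun i _ => ?_
      change T (bosonize D (a ᵍ⊗ₜ[ℂ] parityProj i b)) = _
      rw [bosonize_apply D a (parityProj_mem i b), hT i _ (parityProj_mem i b), mul_assoc, hsq,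
        mul_one]
    exact LinearMap.congr_fun this ((GradedTensorProduct.of ℂ (parity D.ρ) (parity D.ρ)).symm x)
  intro x y h
  apply (GradedTensorProduct.of ℂ (parity D.ρ) (parity D.ρ)).symm.injective
  rw [← hTT, ← hTT, h]

/-- A slice of x ⊗ x is a multiple of x, while the slice attached to h is the component of x along
h. That component is nonzero, so x is proportional to it. -/
lemma eq_single_of_comul {B : V ⊗[ℂ] V} {x : SGAlg D.ρ} (hx : comulHom D B x = x ⊗ₜ x)
    {h : G} (hh : x.coeff h ≠ 0) : ∃ a : Lam D.ρ, x = SkewMonoidAlgebra.single h a := by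
  have e := sliceRight_comul D B h x
  rw [hx, sliceRight_tmul] at e
  set c := (grpCoeff D.ρ h ∘ₗ (grpProj D.ρ).toLinearMap) x
  have hc : c ≠ 0 := by
    intro hc
    rw [hc, zero_smul] at e
    apply hh
    have := congrArg (fun y : SGAlg D.ρ => y.coeff h) e
    simpa [SkewMonoidAlgebra.coeff_single_apply] using this.symm
  refine ⟨c⁻¹ • x.coeff h, ?_⟩
  rw [← SkewMonoidAlgebra.smul_single, ← e, smul_smul, inv_mul_cancel₀ hc, one_smul]

/-- The left coaction of a group-like ah lies in ℂh ⊗ A, whereas an odd part of a would contribute a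
term in uh ⊗ A. -/
lemma mem_even_of_comul [Nontrivial V] {B : V ⊗[ℂ] V} {h : G} {a : Lam D.ρ}
    (hx : comulHom D B (incl D.ρ a * grp D.ρ h) =
      (incl D.ρ a * grp D.ρ h) ⊗ₜ (incl D.ρ a * grp D.ρ h)) :
    incl D.ρ a ∈ parity D.ρ 0 := by
  classical
  -- Since u acts by -1 on V ≠ 0, u ≠ 1; this separates the coefficients at h and at uh.
  have hu : D.u * h ≠ h := by
    intro e
    have hu1 : D.u = 1 := by simpa using e
    obtain ⟨v, hv⟩ := exists_ne (0 : V)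
    have := D.u_act v
    rw [hu1, map_one, Module.End.one_apply] at this
    have h2 : (2 : ℂ) • v = 0 := by rw [two_smul]; nth_rw 1 [this]; exact neg_add_cancel v
    exact hv ((smul_eq_zero.mp h2).resolve_left two_ne_zero)
  have e := grpProj_left_comul D B a h
  rw [hx, Algebra.TensorProduct.map_tmul, map_mul, grpProj_incl, grpProj_grp] at e
  have h1 : uu D ^ (1 : ZMod 2).val = uu D := pow_one _
  have h0 : uu D ^ (0 : ZMod 2).val = 1 := pow_zero _
  have hd : incl D.ρ a = parityProj 0 (incl D.ρ a) + parityProj 1 (incl D.ρ a) :=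
    (parityProj_sum (incl D.ρ a)).symm.trans (Fin.sum_univ_two _)
  have hb : bosonRight D (incl D.ρ a) =
      1 ⊗ₜ parityProj 0 (incl D.ρ a) + uu D ⊗ₜ parityProj 1 (incl D.ρ a) := by
    conv_lhs => rw [hd]
    rw [map_add, bosonRight_apply D (parityProj_mem 0 _), bosonRight_apply D (parityProj_mem 1 _),
      h0, h1]
  rw [hb, add_mul, Algebra.TensorProduct.tmul_mul_tmul, Algebra.TensorProduct.tmul_mul_tmul,
    one_mul, uu, ← map_mul] at e
  -- The coefficient at uh in the left factor isolates a₁h, and it is zero on the side of x ⊗ x.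
  have e2 := congrArg (sliceLeft (grpCoeff D.ρ (D.u * h))) e
  rw [map_add, sliceLeft_tmul, sliceLeft_tmul, sliceLeft_tmul, ← Algebra.smul_def, map_smul,
    grpCoeff_grp, grpCoeff_grp, if_neg hu.symm, if_pos rfl, smul_zero, zero_smul, zero_smul,
    zero_add, one_smul] at e2
  have e3 : parityProj 1 (incl D.ρ a) = 0 := ((grp_isUnit D.ρ h).mul_left_eq_zero).mp e2.symm
  rw [hd, e3, add_zero]
  exact parityProj_mem 0 _

/-- If `A(G, V, u, B)` has a group-like element in `ΛV · h`, then `B` is fixed by `h`. -/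
lemma tprod_apply_eq_of_comul [Nontrivial V] {B : symTensors V} {h : G} {a : Lam D.ρ}
    (hunit : IsUnit (incl D.ρ a * grp D.ρ h))
    (hx : comulHom D B (incl D.ρ a * grp D.ρ h) =
      (incl D.ρ a * grp D.ρ h) ⊗ₜ (incl D.ρ a * grp D.ρ h)) :
    D.ρ.tprod D.ρ h (B : V ⊗[ℂ] V) = B := by
  have ha := mem_even_of_comul hx
  have haL : a ∈ lamParity D.ρ 0 :=
    mem_lamParity_of_single (g := 1) ha
  set x := incl D.ρ a * grp D.ρ h with hxdef
  have hx0 : x ∈ parity D.ρ 0 := by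
    have := SetLike.GradedMul.mul_mem ha (grp_mem (ρ := D.ρ) h)
    rwa [add_zero] at this
  have h0 : uu D ^ (0 : ZMod 2).val = 1 := pow_zero _
  set P : SGAlg2 D.ρ := x ᵍ⊗ₜ[ℂ] x with hP
  have hPunit : IsUnit P := by
    have hPe : P = GradedTensorProduct.includeLeft (parity D.ρ) (parity D.ρ) x *
        GradedTensorProduct.includeRight (parity D.ρ) (parity D.ρ) x := by
      change P = (x ᵍ⊗ₜ[ℂ] 1) * (1 ᵍ⊗ₜ[ℂ] x)
      rw [st_mul _ _ one_mem' one_mem' (zero_mul _), mul_one, one_mul]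
    rw [hPe]
    exact (hunit.map _).mul (hunit.map _)
  -- For even x, bosonization introduces no power of u on x ⊗ x, so the group-like equation lifts to
  -- the super tensor square.
  have htw : twistedComul D.ρ B x = P := by
    apply bosonize_injective
    refine Eq.trans hx ?_
    rw [hP, bosonize_apply D x hx0, h0, mul_one]
  set T := tens D.ρ (B : V ⊗[ℂ] V) with hT
  have nT : IsNilpotent T := tens_nilpotent _
  set S := superComul D.ρ x
  have e1 : nilExp (-T) * S * nilExp T = P := by
    rw [← htw]
    change _ = conjHom (superTwist D.ρ B) S
    rw [conjHom_apply]
    rfl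
  have fT : superFlip D.ρ T = -T := by
    rw [hT, superFlip_tens, show TensorProduct.comm ℂ V V (B : V ⊗[ℂ] V) = B from B.2]
  -- Applying the super flip to `e1` fixes S and P (x is even) and replaces T by -T.
  have e2 : nilExp T * S * nilExp (-T) = P := by
    have := congrArg (superFlip D.ρ) e1
    rwa [map_mul, map_mul, map_nilExp _ nT, map_nilExp _ nT.neg, map_neg, fT, neg_neg,
      superFlip_superComul, hP, superFlip_tmul hx0 hx0 (zero_mul _)] at this
  have m1 := nilExp_mul_neg nT
  have m2 := nilExp_neg_mul nT
  -- By `e1` and `e2`, both products equal e^T S e^T.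
  have e3 : P * nilExp (T + T) = nilExp (T + T) * P := by
    rw [nilExp_add (Commute.refl T) nT nT]
    calc P * (nilExp T * nilExp T)
        = nilExp T * S * (nilExp (-T) * nilExp T) * nilExp T := by
          rw [← e2]; simp only [mul_assoc]
      _ = nilExp T * (nilExp T * nilExp (-T)) * S * nilExp T := by
          rw [m1, m2, mul_one, mul_one]
      _ = nilExp T * nilExp T * P := by rw [← e1]; simp only [mul_assoc]
  -- The factor a ⊗ a commutes with V ⊗ V since a is even, so only h ⊗ h acts.
  have e4 : ∀ t, P * tens D.ρ t = tens D.ρ (D.ρ.tprod D.ρ h t) * P := by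
    have hPe : P = (incl D.ρ a ᵍ⊗ₜ[ℂ] incl D.ρ a) * (grp D.ρ h ᵍ⊗ₜ[ℂ] grp D.ρ h) := by
      rw [st_mul _ _ ha (grp_mem h) (zero_mul _)]
    have hc : ∀ t, Commute (incl D.ρ a ᵍ⊗ₜ[ℂ] incl D.ρ a) (tens D.ρ t) := by
      intro t
      induction t using TensorProduct.induction_on with
      | zero => simp
      | add x y hx hy => rw [map_add]; exact hx.add_right hy
      | tmul v w =>
        rw [commute_iff_eq, tens_tmul, st_mul _ _ ha (vec_mem v) (zero_mul _),
          st_mul _ _ (vec_mem w) ha (mul_zero _), (commute_vec_incl haL v).eq,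
          (commute_vec_incl haL w).eq]
    intro t
    rw [hPe, mul_assoc, grp_tmul_mul_tens, ← mul_assoc, (hc _).eq, mul_assoc]
  set t2 : V ⊗[ℂ] V := (B : V ⊗[ℂ] V) + B
  have e5 : P * nilExp (T + T) = nilExp (tens D.ρ (D.ρ.tprod D.ρ h t2)) * P := by
    obtain ⟨U, hU⟩ := hPunit
    have hconj : conjHom U (tens D.ρ (D.ρ.tprod D.ρ h t2)) = T + T := by
      rw [conjHom_apply, mul_assoc, hU, ← e4, ← hU, Units.inv_mul_cancel_left, hT, ← map_add]
    rw [← hconj, ← map_nilExp _ (tens_nilpotent _), conjHom_apply, mul_assoc, ← hU,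
      Units.mul_inv_cancel_left]
  -- Comparing `e5` with `e3` and cancelling the unit P leaves e^(2hB) = e^(2B).
  have e6 : nilExp (tens D.ρ (D.ρ.tprod D.ρ h t2)) = nilExp (tens D.ρ t2) := by
    have := e5.symm.trans e3
    rw [hPunit.mul_right_cancel this, hT, ← map_add]
  have e7 := tens_injective D.ρ
    (nilExp_injective (tens_commute _ _) (tens_nilpotent _) (tens_nilpotent _) e6)
  rw [map_add, ← two_smul ℂ, show t2 = (2 : ℂ) • (B : V ⊗[ℂ] V) from (two_smul ℂ _).symm] at e7
  exact smul_right_injective _ (two_ne_zero : (2 : ℂ) ≠ 0) e7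

end GroupLike

/-! ### Generalities on simple subcoalgebras and pointedness. -/

section Coalgebra
variable {K C : Type*} [Field K] [AddCommGroup C] [Module K C] [Coalgebra K C]

lemma exists_isSimpleSubcoalgebra_le [Module.Finite K C] (n : ℕ) (E : Submodule K C)
    (hn : Module.finrank K E = n) (hE : IsSubcoalgebra E) (h0 : E ≠ ⊥) :
    ∃ S ≤ E, IsSimpleSubcoalgebra S := by
  induction n using Nat.strong_induction_on generalizing E with
  | _ n ih =>
    by_cases hs : ∀ E' ≤ E, IsSubcoalgebra E' → E' = ⊥ ∨ E' = E
    · exact ⟨E, le_rfl, hE, h0, hs⟩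
    · push Not at hs
      obtain ⟨E', hle, hE', hb, hne⟩ := hs
      obtain ⟨S, hS, hS'⟩ := ih _ (hn ▸ Submodule.finrank_lt_finrank_of_lt (hle.lt_of_ne hne)) E'
        rfl hE' hb
      exact ⟨S, hS.trans hle, hS'⟩

/-- By finite dimension there is a simple subcoalgebra inside E; pointedness makes it a line spanned
by some s, so Δ(s) = c s ⊗ s. The counit axiom gives c ε(s) = 1, and c s is group-like. -/
lemma IsPointedCoalgebra.exists_isGroupLikeElem [Module.Finite K C]
    (hp : IsPointedCoalgebra K C) {E : Submodule K C} (hE : IsSubcoalgebra E) (h0 : E ≠ ⊥) :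
    ∃ x ∈ E, IsGroupLikeElem K x := by
  obtain ⟨S, hSE, hS⟩ := exists_isSimpleSubcoalgebra_le _ E rfl hE h0
  obtain ⟨s, hs0, hs⟩ := finrank_eq_one_iff'.mp (hp S hS)
  have hcom : ∃ c : K, Coalgebra.comul (R := K) (s : C) = c • ((s : C) ⊗ₜ[K] (s : C)) := by
    obtain ⟨t, ht⟩ := hS.1 s s.2
    rw [← ht]
    clear ht
    induction t using TensorProduct.induction_on with
    | zero => exact ⟨0, by simp⟩
    | add x y hx hy =>
      obtain ⟨c, hc⟩ := hx
      obtain ⟨d, hd⟩ := hy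
      exact ⟨c + d, by rw [map_add, hc, hd, add_smul]⟩
    | tmul x y =>
      obtain ⟨c, rfl⟩ := hs x
      obtain ⟨d, rfl⟩ := hs y
      exact ⟨c * d, by rw [TensorProduct.smul_tmul_smul, map_smul]; rfl⟩
  obtain ⟨c, hc⟩ := hcom
  have h1 : (c * Coalgebra.counit (R := K) (s : C)) • (s : C) = s := by
    have h := Coalgebra.rTensor_counit_comul (R := K) (s : C)
    have h2 := congrArg (TensorProduct.lid K C) h
    rw [hc, map_smul] at h2
    simpa [smul_smul] using h2
  have hs0' : (s : C) ≠ 0 := by simpa using hs0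
  have h2 : c * Coalgebra.counit (R := K) (s : C) = 1 := by
    have : (c * Coalgebra.counit (R := K) (s : C) - 1) • (s : C) = 0 := by
      rw [sub_smul, h1, one_smul, sub_self]
    exact sub_eq_zero.mp ((smul_eq_zero.mp this).resolve_right hs0')
  refine ⟨c • (s : C), E.smul_mem _ (hSE s.2), ?_, ?_⟩
  · rw [map_smul, smul_eq_mul, h2]
  · rw [map_smul, hc, TensorProduct.smul_tmul_smul, smul_smul]

lemma isSubcoalgebra_span_singleton {x : C} {c : K}
    (hx : Coalgebra.comul (R := K) x = c • (x ⊗ₜ[K] x)) : IsSubcoalgebra (Submodule.span K {x}) := by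
  intro y hy
  obtain ⟨d, rfl⟩ := Submodule.mem_span_singleton.mp hy
  let x' : Submodule.span K {x} := ⟨x, Submodule.mem_span_singleton_self x⟩
  exact ⟨(d * c) • (x' ⊗ₜ x'), by rw [map_smul, map_smul, hx, mul_smul]; rfl⟩

/-- The line through a group-like element is a subcoalgebra, so it fills any simple subcoalgebra
containing it. -/
lemma isPointedCoalgebra_of_forall_exists
    (h : ∀ E : Submodule K C, IsSubcoalgebra E → E ≠ ⊥ → ∃ x ∈ E, IsGroupLikeElem K x) :
    IsPointedCoalgebra K C := by
  rintro E ⟨hE, h0, hs⟩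
  obtain ⟨x, hx, hg⟩ := h E hE h0
  have hsub : IsSubcoalgebra (Submodule.span K {x}) :=
    isSubcoalgebra_span_singleton (c := 1) (by rw [hg.comul_eq_tmul_self, one_smul])
  have hx0 : x ≠ 0 := hg.ne_zero
  have hne : Submodule.span K {x} ≠ ⊥ := by simpa using hx0
  rw [← (hs _ (by simpa using hx) hsub).resolve_left hne]
  exact finrank_span_singleton hx0

variable {C' : Type*} [AddCommGroup C'] [Module K C'] [Coalgebra K C']

lemma IsSubcoalgebra.map {E : Submodule K C} (hE : IsSubcoalgebra E) (f : C →ₗc[K] C') :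
    IsSubcoalgebra (E.map (f : C →ₗ[K] C')) := by
  rintro _ ⟨x, hx, rfl⟩
  obtain ⟨t, ht⟩ := hE x hx
  let f' : E →ₗ[K] E.map (f : C →ₗ[K] C') := (f : C →ₗ[K] C').submoduleMap E
  refine ⟨TensorProduct.map f' f' t, ?_⟩
  have h : Coalgebra.comul (R := K) ((f : C →ₗ[K] C') x) =
      TensorProduct.map (f : C →ₗ[K] C') (f : C →ₗ[K] C') (Coalgebra.comul (R := K) x) :=
    (LinearMap.congr_fun f.map_comp_comul x).symm
  rw [h, ← ht, ← LinearMap.comp_apply, ← LinearMap.comp_apply, ← TensorProduct.map_comp,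
    ← TensorProduct.map_comp]
  rfl

lemma IsPointedCoalgebra.of_equiv (e : C ≃ₗc[K] C') (hp : IsPointedCoalgebra K C') :
    IsPointedCoalgebra K C := by
  rintro E ⟨hE, h0, hs⟩
  have hmap : ∀ F : Submodule K C,
      F.map ((e : C →ₗc[K] C') : C →ₗ[K] C') = F.map (e.toLinearEquiv : C →ₗ[K] C') := fun _ => rfl
  have hsymm : ∀ F : Submodule K C',
      F.map ((e.symm : C' →ₗc[K] C) : C' →ₗ[K] C) =
        F.map (e.toLinearEquiv.symm : C' →ₗ[K] C) := fun _ => rfl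
  have hinv : ∀ F : Submodule K C', (F.map (e.toLinearEquiv.symm : C' →ₗ[K] C)).map
      (e.toLinearEquiv : C →ₗ[K] C') = F := fun F => by
    rw [← Submodule.map_comp, LinearEquiv.comp_symm, Submodule.map_id]
  have hinv' : ∀ F : Submodule K C, (F.map (e.toLinearEquiv : C →ₗ[K] C')).map
      (e.toLinearEquiv.symm : C' →ₗ[K] C) = F := fun F => by
    rw [← Submodule.map_comp, LinearEquiv.symm_comp, Submodule.map_id]
  have h := hp (E.map (e.toLinearEquiv : C →ₗ[K] C')) ⟨hmap E ▸ hE.map (e : C →ₗc[K] C'), ?_, ?_⟩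
  · rwa [LinearEquiv.finrank_map_eq] at h
  · intro h
    apply h0
    rw [← hinv' E, h, Submodule.map_bot]
  · intro F hF hFs
    have hle : F.map (e.toLinearEquiv.symm : C' →ₗ[K] C) ≤ E := by
      rw [← hinv' E]; exact Submodule.map_mono hF
    rcases hs _ hle (hsymm F ▸ hFs.map (e.symm : C' →ₗc[K] C)) with h | h
    · left; rw [← hinv F, h, Submodule.map_bot]
    · right; rw [← hinv F, h]

end Coalgebra

/-! ### Finite-dimensionality of ΛV and of ℂ[G ⋉ V]. -/

section Finite

instance [FiniteDimensional ℂ V] (ρ : Representation ℂ G V) : Module.Finite ℂ (Lam ρ) := by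
  change Module.Finite ℂ (ExteriorAlgebra ℂ V)
  set d := Module.finrank ℂ V
  -- Exterior powers above the dimension of V vanish, so finitely many finite-dimensional powers
  -- span ΛV.
  have hzero : ∀ k, d < k → (⋀[ℂ]^k V : Submodule ℂ (ExteriorAlgebra ℂ V)) = ⊥ := by
    intro k hk
    rw [← Submodule.finrank_eq_zero, exteriorPower.finrank_eq, Nat.choose_eq_zero_of_lt hk]
  have htop : (⊤ : Submodule ℂ (ExteriorAlgebra ℂ V)) =
      ⨆ k : Fin (d + 1), (⋀[ℂ]^(k : ℕ) V : Submodule ℂ (ExteriorAlgebra ℂ V)) := by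
    rw [← (DirectSum.Decomposition.isInternal
      (fun i : ℕ => (⋀[ℂ]^i V : Submodule ℂ (ExteriorAlgebra ℂ V)))).submodule_iSup_eq_top]
    refine le_antisymm (iSup_le fun k => ?_) (iSup_le fun k => le_iSup
      (fun i : ℕ => (⋀[ℂ]^i V : Submodule ℂ (ExteriorAlgebra ℂ V))) k)
    by_cases hk : k < d + 1
    · exact le_iSup (fun k : Fin (d + 1) =>
        (⋀[ℂ]^(k : ℕ) V : Submodule ℂ (ExteriorAlgebra ℂ V))) ⟨k, hk⟩
    · rw [hzero k (by omega)]; exact bot_le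
  rw [Module.finite_def, htop]
  exact Submodule.fg_iSup _ fun k => (Module.Finite.iff_fg).mp inferInstance

instance [Finite G] [FiniteDimensional ℂ V] (ρ : Representation ℂ G V) :
    Module.Finite ℂ (SGAlg ρ) :=
  Module.Finite.equiv (SkewMonoidAlgebra.coeffLinearEquiv (S := ℂ)).symm

end Finite

/-! ### The subcoalgebras Kg, with K generated by V and u, and the proof that pointedness forces
invariance. -/

section Coset
variable (D : SuperGroupDatum G V)

/-- The subalgebra of `ℂ[G ⋉ V]` generated by `V` and `u`. -/
def vecParityAlg : Subalgebra ℂ (SGAlg D.ρ) :=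
  Algebra.adjoin ℂ (Set.range (vec D.ρ) ∪ {uu D})

lemma vec_mem_vecParityAlg (v : V) : vec D.ρ v ∈ vecParityAlg D :=
  Algebra.subset_adjoin (Or.inl ⟨v, rfl⟩)

lemma uu_mem_vecParityAlg : uu D ∈ vecParityAlg D := Algebra.subset_adjoin (Or.inr rfl)

/-- The tensor square of `vecParityAlg D`, as a subalgebra of the tensor square of `ℂ[G ⋉ V]`. -/
def vecParityAlg2 : Subalgebra ℂ (SGAlg D.ρ ⊗[ℂ] SGAlg D.ρ) :=
  (Algebra.TensorProduct.map (vecParityAlg D).val (vecParityAlg D).val).range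

variable {D}

lemma tmul_mem_vecParityAlg2 {x y : SGAlg D.ρ} (hx : x ∈ vecParityAlg D)
    (hy : y ∈ vecParityAlg D) : x ⊗ₜ y ∈ vecParityAlg2 D :=
  ⟨(⟨x, hx⟩ : vecParityAlg D) ⊗ₜ (⟨y, hy⟩ : vecParityAlg D), rfl⟩

lemma bten_mem_vecParityAlg2 (t : V ⊗[ℂ] V) : bten D t ∈ vecParityAlg2 D := by
  induction t using TensorProduct.induction_on with
  | zero => rw [map_zero]; exact zero_mem _
  | add x y hx hy => rw [map_add]; exact add_mem hx hy
  | tmul v w =>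
    rw [bten_tmul]
    exact tmul_mem_vecParityAlg2 (mul_mem (vec_mem_vecParityAlg D v) (uu_mem_vecParityAlg D))
      (vec_mem_vecParityAlg D w)

lemma nilExp_mem {X : Type*} [Ring X] [Algebra ℂ X] (S : Subalgebra ℂ X) {x : X} (hx : x ∈ S) :
    nilExp x ∈ S :=
  S.sum_mem fun _ _ => S.smul_mem (S.pow_mem hx _) _

/-- The coproducts of the generators v and u do not involve B, and they lie in K ⊗ K. The element u
belongs to K precisely because it occurs in Δ(v). -/
lemma comulHom_mem_vecParityAlg2 (B : V ⊗[ℂ] V) {x : SGAlg D.ρ} (hx : x ∈ vecParityAlg D) :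
    comulHom D B x ∈ vecParityAlg2 D := by
  have h : vecParityAlg D ≤ (vecParityAlg2 D).comap (comulHom D B) := by
    refine Algebra.adjoin_le ?_
    rintro _ (⟨v, rfl⟩ | rfl)
    · change comulHom D B (vec D.ρ v) ∈ vecParityAlg2 D
      rw [comul_vec]
      exact add_mem (tmul_mem_vecParityAlg2 (vec_mem_vecParityAlg D v) (one_mem _))
        (tmul_mem_vecParityAlg2 (uu_mem_vecParityAlg D) (vec_mem_vecParityAlg D v))
    · change comulHom D B (uu D) ∈ vecParityAlg2 D
      rw [comul_uu]
      exact tmul_mem_vecParityAlg2 (uu_mem_vecParityAlg D) (uu_mem_vecParityAlg D)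
  exact h hx

lemma grp_tmul_mul_bten (g : G) (t : V ⊗[ℂ] V) :
    (grp D.ρ g ⊗ₜ[ℂ] grp D.ρ g) * bten D t =
      bten D (D.ρ.tprod D.ρ g t) * (grp D.ρ g ⊗ₜ grp D.ρ g) := by
  induction t using TensorProduct.induction_on with
  | zero => simp
  | add x y hx hy => simp only [map_add, mul_add, add_mul, hx, hy]
  | tmul v w =>
    rw [Representation.tprod_apply, TensorProduct.map_tmul, bten_tmul, bten_tmul,
      Algebra.TensorProduct.tmul_mul_tmul, Algebra.TensorProduct.tmul_mul_tmul, ← mul_assoc,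
      grp_mul_vec, grp_mul_vec, mul_assoc, mul_assoc, uu_mul_grp]

/-- Conjugation by g ⊗ g carries b(B) to b(gB), hence e^b(B) to e^b(gB). The prefactor measures the
failure of g to be group-like. -/
lemma comul_grp_eq (B : V ⊗[ℂ] V) (g : G) :
    comulHom D B (grp D.ρ g) = nilExp (-bten D B) * nilExp (bten D (D.ρ.tprod D.ρ g B)) *
      (grp D.ρ g ⊗ₜ grp D.ρ g) := by
  obtain ⟨U, hU⟩ : IsUnit (grp D.ρ g ⊗ₜ[ℂ] grp D.ρ g) := by
    have := ((grp_isUnit D.ρ g).map (Algebra.TensorProduct.includeLeft : SGAlg D.ρ →ₐ[ℂ] _)).mul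
      ((grp_isUnit D.ρ g).map (Algebra.TensorProduct.includeRight :
        SGAlg D.ρ →ₐ[ℂ] SGAlg D.ρ ⊗[ℂ] SGAlg D.ρ))
    simpa using this
  have hconj : conjHom U (bten D (D.ρ.tprod D.ρ g B)) = bten D B := by
    rw [conjHom_apply, mul_assoc, hU, ← grp_tmul_mul_bten, ← hU, Units.inv_mul_cancel_left]
  rw [comul_grp, conjHom_apply, mul_assoc, mul_assoc]
  change nilExp (-bten D B) * (_ * nilExp (bten D B)) = _
  congr 1
  rw [← hU]
  nth_rw 1 [← hconj]
  rw [← map_nilExp _ (bten_nilpotent D _), conjHom_apply, mul_assoc, Units.mul_inv_cancel_left]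

/-- A subspace of `ℂ[G ⋉ V]`, regarded as a subspace of `A(G, V, u, B)`. -/
def toHopfA (B : symTensors V) (E : Submodule ℂ (SGAlg D.ρ)) : Submodule ℂ (HopfA D B) := E

variable (D) in
/-- The right translate by `g` of the subalgebra generated by `V` and `u`. -/
def coset (g : G) : Submodule ℂ (SGAlg D.ρ) :=
  (Subalgebra.toSubmodule (vecParityAlg D)).map (LinearMap.mulRight ℂ (grp D.ρ g))

/-- In Δ(xg) = Δ(x) e^(-b(B)) e^(b(gB)) (g ⊗ g), everything before g ⊗ g lies in K ⊗ K. -/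
lemma coset_isSubcoalgebra (B : symTensors V) (g : G) :
    IsSubcoalgebra (toHopfA B (coset D g)) := by
  rintro _ ⟨x, hx, rfl⟩
  have h1 : comulHom D B (x * grp D.ρ g) =
      comulHom D B x * nilExp (-bten D B) * nilExp (bten D (D.ρ.tprod D.ρ g B)) *
        (grp D.ρ g ⊗ₜ grp D.ρ g) := by
    rw [map_mul, comul_grp_eq]; simp only [mul_assoc]
  have h2 : comulHom D B x * nilExp (-bten D B) * nilExp (bten D (D.ρ.tprod D.ρ g B)) ∈
      vecParityAlg2 D :=
    mul_mem (mul_mem (comulHom_mem_vecParityAlg2 _ hx)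
      (nilExp_mem _ (neg_mem (bten_mem_vecParityAlg2 _)))) (nilExp_mem _ (bten_mem_vecParityAlg2 _))
  have h3 : ∀ t : SGAlg D.ρ ⊗[ℂ] SGAlg D.ρ, t ∈ vecParityAlg2 D →
      t * (grp D.ρ g ⊗ₜ grp D.ρ g) ∈
        LinearMap.range (TensorProduct.map (coset D g).subtype (coset D g).subtype) := by
    rintro _ ⟨s, rfl⟩
    change Algebra.TensorProduct.map (vecParityAlg D).val (vecParityAlg D).val s * _ ∈ _
    induction s using TensorProduct.induction_on with
    | zero => rw [map_zero, zero_mul]; exact zero_mem _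
    | add x y hx hy => rw [map_add, add_mul]; exact add_mem hx hy
    | tmul x y =>
      rw [Algebra.TensorProduct.map_tmul, Algebra.TensorProduct.tmul_mul_tmul]
      exact ⟨(⟨_, x, x.2, rfl⟩ : coset D g) ⊗ₜ (⟨_, y, y.2, rfl⟩ : coset D g), rfl⟩
  have h4 := h3 _ h2
  rw [← h1] at h4
  exact h4

/-- The space ΛV + ΛV u is closed under products, since u normalizes ΛV and u² = 1. -/
lemma exists_incl_add_incl_mul_uu {x : SGAlg D.ρ} (hx : x ∈ vecParityAlg D) :
    ∃ a b : Lam D.ρ, x = incl D.ρ a + incl D.ρ b * uu D := by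
  induction hx using Algebra.adjoin_induction with
  | mem x hx =>
    rcases hx with ⟨v, rfl⟩ | rfl
    · exact ⟨(ExteriorAlgebra.ι ℂ v : ExteriorAlgebra ℂ V), 0, by rw [map_zero, zero_mul, add_zero]; rfl⟩
    · exact ⟨0, 1, by simp⟩
  | algebraMap c => exact ⟨algebraMap ℂ _ c, 0, by simp⟩
  | add x y _ _ hx hy =>
    obtain ⟨a, b, rfl⟩ := hx
    obtain ⟨a', b', rfl⟩ := hy
    exact ⟨a + a', b + b', by rw [map_add, map_add, add_mul]; abel⟩
  | mul x y _ _ hx hy =>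
    obtain ⟨a, b, rfl⟩ := hx
    obtain ⟨a', b', rfl⟩ := hy
    refine ⟨a * a' + b * (D.u • b'), a * b' + b * (D.u • a'), ?_⟩
    have h : ∀ c : Lam D.ρ, uu D * incl D.ρ c = incl D.ρ (D.u • c) * uu D :=
      fun c => grp_mul_incl D.ρ c D.u
    have e1 : incl D.ρ b * uu D * (incl D.ρ b' * uu D) = incl D.ρ b * incl D.ρ (D.u • b') := by
      rw [mul_assoc, ← mul_assoc (uu D), h, mul_assoc, uu_mul_uu, mul_one]
    have e2 : incl D.ρ b * uu D * incl D.ρ a' = incl D.ρ b * incl D.ρ (D.u • a') * uu D := by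
      rw [mul_assoc, h, mul_assoc]
    rw [add_mul, mul_add, mul_add, e1, e2]
    simp only [map_add, map_mul, add_mul, mul_assoc]
    abel

lemma coeff_eq_zero_of_mem_coset {g : G} {x : SGAlg D.ρ} (hx : x ∈ coset D g) {k : G}
    (h1 : k ≠ g) (h2 : k ≠ D.u * g) : x.coeff k = 0 := by
  classical
  obtain ⟨y, hy, rfl⟩ := hx
  obtain ⟨a, b, rfl⟩ := exists_incl_add_incl_mul_uu hy
  rw [LinearMap.mulRight_apply, add_mul, mul_assoc, uu, ← map_mul, incl_mul_grp, incl_mul_grp,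
    SkewMonoidAlgebra.coeff_add, Finsupp.add_apply, SkewMonoidAlgebra.coeff_single_apply,
    SkewMonoidAlgebra.coeff_single_apply, if_neg h1.symm, if_neg h2.symm, add_zero]

/-- The two signs of u on V ⊗ V cancel, so it does not matter whether the group-like element in Kg
sits over g or over ug. -/
lemma tprod_u_mul_apply (g : G) (t : V ⊗[ℂ] V) :
    D.ρ.tprod D.ρ (D.u * g) t = D.ρ.tprod D.ρ g t := by
  induction t using TensorProduct.induction_on with
  | zero => simp
  | add x y hx hy => rw [map_add, map_add, hx, hy]
  | tmul v w =>
    simp only [Representation.tprod_apply, TensorProduct.map_tmul, map_mul, Module.End.mul_apply,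
      D.u_act, TensorProduct.neg_tmul, TensorProduct.tmul_neg, neg_neg]

/-- If `A(G, V, u, B)` is pointed, then `B` is `G`-invariant. -/
theorem mem_invariants_of_isPointedCoalgebra [Finite G] [FiniteDimensional ℂ V] {B : symTensors V}
    (hp : IsPointedCoalgebra ℂ (HopfA D B)) :
    (B : V ⊗[ℂ] V) ∈ (D.ρ.tprod D.ρ).invariants := by
  intro g
  -- For V = 0 there is nothing to prove; otherwise u ≠ 1, as the parity argument needs.
  rcases subsingleton_or_nontrivial V with hV | hV
  · exact Subsingleton.elim _ _
  have : Module.Finite ℂ (HopfA D B) := inferInstanceAs (Module.Finite ℂ (SGAlg D.ρ))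
  have h0 : toHopfA B (coset D g) ≠ ⊥ := by
    refine (Submodule.ne_bot_iff _).mpr ⟨grp D.ρ g, ⟨1, one_mem (vecParityAlg D), one_mul _⟩, ?_⟩
    exact grp_ne_zero D.ρ g
  obtain ⟨x, hx, hgl⟩ := hp.exists_isGroupLikeElem (coset_isSubcoalgebra B g) h0
  have hcom : comulHom D B x = (x : SGAlg D.ρ) ⊗ₜ (x : SGAlg D.ρ) := hgl.comul_eq_tmul_self
  have hx0 : (x : SGAlg D.ρ) ≠ 0 := hgl.ne_zero
  have hunit : IsUnit (x : SGAlg D.ρ) := hgl.isUnit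
  obtain ⟨h, hh⟩ : ∃ h, SkewMonoidAlgebra.coeff (x : SGAlg D.ρ) h ≠ 0 := by
    by_contra! hc
    exact hx0 (SkewMonoidAlgebra.ext hc)
  obtain ⟨a, ha⟩ := eq_single_of_comul hcom hh
  rw [← incl_mul_grp] at ha
  rw [ha] at hcom hunit
  have hB := tprod_apply_eq_of_comul hunit hcom
  -- Elements of Kg are supported on g and ug, so h is one of these.
  by_cases h1 : h = g
  · rwa [h1] at hB
  by_cases h2 : h = D.u * g
  · rwa [h2, tprod_u_mul_apply] at hB
  · exact absurd (coeff_eq_zero_of_mem_coset hx h1 h2) hh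

end Coset

/-! ### The filtration of ℂ[G ⋉ V] by degree in V. -/

section Filtration
variable (ρ : Representation ℂ G V)

/-- The subspace `ℂ[G]` of `ℂ[G ⋉ V]`. -/
def grpSpan : Submodule ℂ (SGAlg ρ) := Submodule.span ℂ (Set.range (grp ρ))

/-- The subspace of `ℂ[G ⋉ V]` of elements of degree less than `n` in `V`. -/
def degreeLT : ℕ → Submodule ℂ (SGAlg ρ)
  | 0 => ⊥
  | n + 1 => grpSpan ρ ⊔ degreeLT n ⊔ LinearMap.range (vec ρ) * degreeLT n

lemma grpSpan_le_degreeLT (n : ℕ) : grpSpan ρ ≤ degreeLT ρ (n + 1) :=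
  le_sup_left.trans le_sup_left

lemma degreeLT_le_succ (n : ℕ) : degreeLT ρ n ≤ degreeLT ρ (n + 1) :=
  le_sup_right.trans le_sup_left

lemma degreeLT_mono : Monotone (degreeLT ρ) := monotone_nat_of_le_succ (degreeLT_le_succ ρ)

variable {ρ}

lemma vec_mul_mem_degreeLT {n : ℕ} (v : V) {y : SGAlg ρ} (hy : y ∈ degreeLT ρ n) :
    vec ρ v * y ∈ degreeLT ρ (n + 1) :=
  (le_sup_right : _ ≤ degreeLT ρ (n + 1)) (Submodule.mul_mem_mul ⟨v, rfl⟩ hy)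

/-- Induction along the filtration by degree. -/
lemma degreeLT_induction {p : ℕ → SGAlg ρ → Prop} (hzero : ∀ n, p n 0)
    (hadd : ∀ n x y, p n x → p n y → p n (x + y)) (hsmul : ∀ n (c : ℂ) x, p n x → p n (c • x))
    (hgrp : ∀ n g, p (n + 1) (grp ρ g)) (hsucc : ∀ n x, p n x → p (n + 1) x)
    (hvec : ∀ n v x, x ∈ degreeLT ρ n → p n x → p (n + 1) (vec ρ v * x)) {n : ℕ} {x : SGAlg ρ}
    (hx : x ∈ degreeLT ρ n) : p n x := by
  let P : ℕ → Submodule ℂ (SGAlg ρ) := fun n =>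
    { carrier := {x | p n x}
      zero_mem' := hzero n
      add_mem' := fun {x y} hx hy => hadd n x y hx hy
      smul_mem' := fun c x hx => hsmul n c x hx }
  suffices h : ∀ n, degreeLT ρ n ≤ P n from h n hx
  intro n
  induction n with
  | zero => exact bot_le
  | succ n ih =>
    refine sup_le (sup_le ?_ fun x hx => hsucc n x (ih hx)) ?_
    · refine Submodule.span_le.mpr ?_
      rintro _ ⟨g, rfl⟩
      exact hgrp n g
    · refine Submodule.mul_le.mpr ?_
      rintro _ ⟨v, rfl⟩ y hy
      exact hvec n v y hy (ih hy)

lemma grp_mul_mem_degreeLT (g : G) {n : ℕ} {x : SGAlg ρ} (hx : x ∈ degreeLT ρ n) :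
    grp ρ g * x ∈ degreeLT ρ n := by
  refine degreeLT_induction (p := fun n x => grp ρ g * x ∈ degreeLT ρ n) (fun n => ?_)
    (fun n x y hx hy => ?_) (fun n c x hx => ?_) (fun n h => ?_)
    (fun n x hx => degreeLT_le_succ ρ n hx) (fun n v x _ hx => ?_) hx
  · rw [mul_zero]; exact zero_mem _
  · rw [mul_add]; exact add_mem hx hy
  · rw [mul_smul_comm]; exact Submodule.smul_mem _ _ hx
  · rw [← map_mul]; exact grpSpan_le_degreeLT ρ n (Submodule.subset_span ⟨_, rfl⟩)
  · rw [← mul_assoc, grp_mul_vec, mul_assoc]; exact vec_mul_mem_degreeLT _ hx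

lemma exists_mem_degreeLT (x : SGAlg ρ) : ∃ n, x ∈ degreeLT ρ n := by
  -- The statement is strengthened to left multiplication by x so that it passes to products; y = 1
  -- recovers it.
  suffices h : ∀ y : SGAlg ρ, (∃ n, y ∈ degreeLT ρ n) → ∃ n, x * y ∈ degreeLT ρ n by
    have := h 1 ⟨1, grpSpan_le_degreeLT ρ 0 (Submodule.subset_span ⟨1, map_one _⟩)⟩
    rwa [mul_one] at this
  induction x using sgAlg_induction with
  | hv v => rintro y ⟨n, hn⟩; exact ⟨n + 1, vec_mul_mem_degreeLT v hn⟩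
  | hg g => rintro y ⟨n, hn⟩; exact ⟨n, grp_mul_mem_degreeLT g hn⟩
  | hc c =>
    rintro y ⟨n, hn⟩
    exact ⟨n, by rw [← Algebra.smul_def]; exact Submodule.smul_mem _ _ hn⟩
  | hadd a b ha hb =>
    intro y hy
    obtain ⟨m, hm⟩ := ha y hy
    obtain ⟨n, hn⟩ := hb y hy
    exact ⟨max m n, by
      rw [add_mul]
      exact add_mem (degreeLT_mono ρ (le_max_left m n) hm) (degreeLT_mono ρ (le_max_right m n) hn)⟩
  | hmul a b ha hb => intro y hy; rw [mul_assoc]; exact ha _ (hb y hy)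

end Filtration

/-! ### Invariance of B implies pointedness. -/

section Pointed
variable {D : SuperGroupDatum G V}

/-- If the elements of `G` are group-like, slicing the coproduct by a functional that vanishes on
`ℂ[G]` lowers the degree in `V`. -/
lemma sliceRight_comul_mem_degreeLT {B : V ⊗[ℂ] V}
    (hB : ∀ g, comulHom D B (grp D.ρ g) = grp D.ρ g ⊗ₜ grp D.ρ g) {n : ℕ} {x : SGAlg D.ρ}
    (hx : x ∈ degreeLT D.ρ (n + 1)) (f : SGAlg D.ρ →ₗ[ℂ] ℂ)
    (hf : ∀ g, f (grp D.ρ g) = 0) : sliceRight f (comulHom D B x) ∈ degreeLT D.ρ n := by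
  -- The invariant of the induction: modulo terms whose left factor has lower degree, the right
  -- factor of the coproduct lies in ℂ[G].
  let slices : ℕ → Submodule ℂ (SGAlg D.ρ ⊗[ℂ] SGAlg D.ρ) := fun n =>
    Submodule.span ℂ ({t | ∃ y ∈ degreeLT D.ρ n, ∃ g, t = y ⊗ₜ grp D.ρ g} ∪
      {t | ∃ y ∈ degreeLT D.ρ (n - 1), ∃ z, t = y ⊗ₜ z})
  have key : comulHom D B x ∈ slices (n + 1) := by
    refine degreeLT_induction (p := fun n x => comulHom D B x ∈ slices n) (fun n => ?_)
      (fun n x y hx hy => ?_) (fun n c x hx => ?_) (fun n h => ?_) (fun n x hx => ?_)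
      (fun n v x _ hx => ?_) hx
    · rw [map_zero]; exact zero_mem _
    · rw [map_add]; exact add_mem hx hy
    · rw [map_smul]; exact Submodule.smul_mem _ _ hx
    · rw [hB]
      exact Submodule.subset_span
        (Or.inl ⟨_, grpSpan_le_degreeLT D.ρ n (Submodule.subset_span ⟨h, rfl⟩), h, rfl⟩)
    · refine Submodule.span_mono ?_ hx
      rintro _ (⟨y, hy, g, rfl⟩ | ⟨y, hy, z, rfl⟩)
      · exact Or.inl ⟨y, degreeLT_le_succ _ _ hy, g, rfl⟩
      · exact Or.inr ⟨y, degreeLT_mono _ (by omega) hy, z, rfl⟩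
    · rw [map_mul, comul_vec]
      have hle : slices n ≤ (slices (n + 1)).comap (LinearMap.mulLeft ℂ
          (vec D.ρ v ⊗ₜ[ℂ] (1 : SGAlg D.ρ) + uu D ⊗ₜ vec D.ρ v)) := by
        refine Submodule.span_le.mpr ?_
        rintro _ (⟨y, hy, g, rfl⟩ | ⟨y, hy, z, rfl⟩) <;>
          rw [SetLike.mem_coe, Submodule.mem_comap, LinearMap.mulLeft_apply, add_mul,
            Algebra.TensorProduct.tmul_mul_tmul, Algebra.TensorProduct.tmul_mul_tmul, one_mul]
        -- The term v ⊗ 1 raises the left degree and keeps g on the right; the term u ⊗ v spoils the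
        -- right factor but keeps the left degree, now one below the new bound.
        · exact add_mem
            (Submodule.subset_span (Or.inl ⟨_, vec_mul_mem_degreeLT v hy, g, rfl⟩))
            (Submodule.subset_span (Or.inr ⟨_, grp_mul_mem_degreeLT _ hy, _, rfl⟩))
        · refine add_mem (Submodule.subset_span (Or.inr ⟨_, ?_, _, rfl⟩))
            (Submodule.subset_span (Or.inr
              ⟨_, degreeLT_mono _ (by omega) (grp_mul_mem_degreeLT _ hy), _, rfl⟩))
          -- At n = 0 the truncated n - 1 is again 0, where the filtration is zero, so y = 0.
          cases n with
          | zero =>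
            have : y = 0 := hy
            rw [this, mul_zero]; exact zero_mem _
          | succ n => exact vec_mul_mem_degreeLT v hy
      exact hle hx
  have hle : slices (n + 1) ≤ (degreeLT D.ρ n).comap (sliceRight f) := by
    refine Submodule.span_le.mpr ?_
    rintro _ (⟨y, hy, g, rfl⟩ | ⟨y, hy, z, rfl⟩)
    · rw [SetLike.mem_coe, Submodule.mem_comap, sliceRight_tmul, hf, zero_smul]
      exact zero_mem _
    · rw [SetLike.mem_coe, Submodule.mem_comap, sliceRight_tmul]
      exact Submodule.smul_mem _ _ hy
  exact hle key

/-- By the counit axiom the value f(x) is read off the slice, so a vanishing slice forces f(x) = 0.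
-/
lemma counitHom_sliceRight_comul (B : V ⊗[ℂ] V) (f : SGAlg D.ρ →ₗ[ℂ] ℂ) (x : SGAlg D.ρ) :
    counitHom D.ρ (sliceRight f (comulHom D B x)) = f x := by
  have h : ∀ t : SGAlg D.ρ ⊗[ℂ] SGAlg D.ρ, counitHom D.ρ (sliceRight f t) =
      f (Algebra.TensorProduct.lid ℂ (SGAlg D.ρ)
        (Algebra.TensorProduct.map (counitHom D.ρ) (.id ℂ _) t)) := by
    intro t
    induction t using TensorProduct.induction_on with
    | zero => simp
    | add x y hx hy => simp only [map_add, hx, hy]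
    | tmul x y => simp [mul_comm]
  have h2 := DFunLike.congr_fun (counit_left D B) x
  rw [AlgHom.comp_apply] at h2
  rw [h, h2]
  simp

lemma exists_single_coeff_grpProj (x : SGAlg D.ρ) (k : G) :
    ∃ c : ℂ, SkewMonoidAlgebra.single k ((grpProj D.ρ x).coeff k) = c • grp D.ρ k := by
  classical
  induction x using SkewMonoidAlgebra.induction_on with
  | zero => exact ⟨0, by simp⟩
  | add x y hx hy =>
    obtain ⟨c, hc⟩ := hx
    obtain ⟨d, hd⟩ := hy
    exact ⟨c + d, by rw [map_add, SkewMonoidAlgebra.coeff_add, Finsupp.add_apply,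
      SkewMonoidAlgebra.single_add, hc, hd, add_smul]⟩
  | single g a =>
    rw [← incl_mul_grp D.ρ a g, map_mul, grpProj_incl, grpProj_grp, ← Algebra.smul_def]
    refine ⟨if g = k then lamScalar D.ρ a else 0, ?_⟩
    change SkewMonoidAlgebra.single k ((lamScalar D.ρ a • SkewMonoidAlgebra.single g 1 :
      SGAlg D.ρ).coeff k) = _
    rw [SkewMonoidAlgebra.smul_single, SkewMonoidAlgebra.coeff_single_apply]
    split_ifs with h
    · rw [← SkewMonoidAlgebra.smul_single]; rfl
    · simp

/-- If the elements of `G` are group-like in `A(G, V, u, B)`, then every nonzero subcoalgebra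
contains one of them. -/
lemma exists_grp_mem_of_isSubcoalgebra {B : symTensors V}
    (hB : ∀ g, comulHom D B (grp D.ρ g) = grp D.ρ g ⊗ₜ grp D.ρ g)
    (E : Submodule ℂ (SGAlg D.ρ)) (hE : IsSubcoalgebra (toHopfA B E)) (h0 : E ≠ ⊥) :
    ∃ k, grp D.ρ k ∈ E := by
  classical
  have hslice : ∀ (f : SGAlg D.ρ →ₗ[ℂ] ℂ) (x : SGAlg D.ρ), x ∈ E →
      sliceRight f (comulHom D B x) ∈ E := fun f x hx => sliceRight_mem f (hE x hx)
  have hex : ∃ n, ∃ x ∈ E, x ∈ degreeLT D.ρ n ∧ x ≠ 0 := by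
    obtain ⟨x, hx, hx0⟩ := (Submodule.ne_bot_iff _).mp h0
    obtain ⟨n, hn⟩ := exists_mem_degreeLT x
    exact ⟨n, x, hx, hn, hx0⟩
  -- A nonzero element of E of least degree.
  obtain ⟨x, hx, hxn, hx0⟩ := Nat.find_spec hex
  obtain ⟨m, hm⟩ : ∃ m, Nat.find hex = m + 1 := by
    refine Nat.exists_eq_succ_of_ne_zero fun h => hx0 ?_
    rw [h] at hxn
    exact hxn
  rw [hm] at hxn
  have hproj : grpProj D.ρ x = x := by
    refine (sub_eq_zero.mp ((Module.forall_dual_apply_eq_zero_iff ℂ _).mp fun f => ?_)).symm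
    -- The functional f' kills ℂ[G], so the slice by f' lies in E with smaller degree and vanishes
    -- by minimality. Hence f agrees on x and on its projection, for every f.
    set f' : SGAlg D.ρ →ₗ[ℂ] ℂ := f ∘ₗ (LinearMap.id - (grpProj D.ρ).toLinearMap)
    have hf' : ∀ g, f' (grp D.ρ g) = 0 := fun g => by simp [f']
    have hz : sliceRight f' (comulHom D B x) = 0 := by
      by_contra hne
      exact Nat.find_min hex (m := m) (by omega)
        ⟨_, hslice f' x hx, sliceRight_comul_mem_degreeLT hB hxn f' hf', hne⟩
    have := counitHom_sliceRight_comul (B : V ⊗[ℂ] V) f' x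
    rw [hz, map_zero] at this
    exact this.symm
  obtain ⟨k, hk⟩ : ∃ k, x.coeff k ≠ 0 := by
    by_contra! hc
    exact hx0 (SkewMonoidAlgebra.ext hc)
  -- As x lies in ℂ[G], its component along k is a nonzero multiple of k, and it lies in E as a
  -- slice.
  have hmem := hslice (grpCoeff D.ρ k ∘ₗ (grpProj D.ρ).toLinearMap) x hx
  rw [sliceRight_comul] at hmem
  obtain ⟨c, hc⟩ := exists_single_coeff_grpProj x k
  rw [hproj] at hc
  have hc0 : c ≠ 0 := by
    rintro rfl
    rw [zero_smul] at hc
    apply hk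
    have := congrArg (fun y : SGAlg D.ρ => y.coeff k) hc
    simpa [SkewMonoidAlgebra.coeff_single_apply] using this
  refine ⟨k, ?_⟩
  rw [hc] at hmem
  simpa [smul_smul, inv_mul_cancel₀ hc0] using E.smul_mem c⁻¹ hmem

lemma comul_grp_of_mem_invariants {B : V ⊗[ℂ] V} (hB : B ∈ (D.ρ.tprod D.ρ).invariants) (g : G) :
    comulHom D B (grp D.ρ g) = grp D.ρ g ⊗ₜ grp D.ρ g := by
  rw [comul_grp_eq, show D.ρ.tprod D.ρ g B = B from hB g, nilExp_neg_mul (bten_nilpotent D B),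
    one_mul]

/-- If `B` is `G`-invariant, then `A(G, V, u, B)` is pointed. -/
theorem isPointedCoalgebra_of_mem_invariants {B : symTensors V}
    (hB : (B : V ⊗[ℂ] V) ∈ (D.ρ.tprod D.ρ).invariants) : IsPointedCoalgebra ℂ (HopfA D B) := by
  refine isPointedCoalgebra_of_forall_exists fun E hE h0 => ?_
  obtain ⟨k, hk⟩ := exists_grp_mem_of_isSubcoalgebra (B := B) (comul_grp_of_mem_invariants hB) E hE
    h0
  exact ⟨grp D.ρ k, hk, counitHom_grp _ k, comul_grp_of_mem_invariants hB k⟩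

/-- If `B` is `G`-invariant, then `A(G, V, u, B)` and `A(G, V, u, 0)` have the same coproduct. -/
lemma comulHom_eq_of_mem_invariants {B : V ⊗[ℂ] V} (hB : B ∈ (D.ρ.tprod D.ρ).invariants) :
    comulHom D B = comulHom D 0 :=
  sgAlg_hom_ext (fun v => by rw [comul_vec, comul_vec]) fun g => by
    rw [comul_grp_of_mem_invariants hB, comul_grp_of_mem_invariants (zero_mem _)]

/-- If `B` is `G`-invariant, the identity is an isomorphism of `A(G, V, u, B)` with
`A(G, V, u, 0)`. -/
def bialgEquivOfMemInvariants {B : symTensors V}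
    (hB : (B : V ⊗[ℂ] V) ∈ (D.ρ.tprod D.ρ).invariants) : HopfA D B ≃ₐc[ℂ] HopfA D 0 :=
  BialgEquiv.ofAlgEquiv (AlgEquiv.refl : SGAlg D.ρ ≃ₐ[ℂ] SGAlg D.ρ) rfl (by
    have h := comulHom_eq_of_mem_invariants hB
    refine AlgHom.ext fun x => ?_
    refine Eq.trans ?_ (DFunLike.congr_fun h x)
    exact DFunLike.congr_fun (Algebra.TensorProduct.map_id (R := ℂ) (S := ℂ) (A := SGAlg D.ρ)
      (B := SGAlg D.ρ)) (comulHom D B x))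

end Pointed

end SuperHopf
end

theorem corollary5p3 {G V : Type*} [Group G] [Finite G] [AddCommGroup V] [Module ℂ V]
    [FiniteDimensional ℂ V] (D : SuperHopf.SuperGroupDatum G V) (B : SuperHopf.symTensors V) :
    (SuperHopf.IsPointedCoalgebra ℂ (SuperHopf.HopfA D B) ↔
      (B : V ⊗[ℂ] V) ∈ (D.ρ.tprod D.ρ).invariants) ∧
    (SuperHopf.IsPointedCoalgebra ℂ (SuperHopf.HopfA D B) ↔
      Nonempty (SuperHopf.HopfA D B ≃ₐc[ℂ] SuperHopf.HopfA D 0)) := by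
  refine ⟨⟨SuperHopf.mem_invariants_of_isPointedCoalgebra,
    SuperHopf.isPointedCoalgebra_of_mem_invariants⟩, fun h => ?_, fun ⟨e⟩ => ?_⟩
  · exact ⟨SuperHopf.bialgEquivOfMemInvariants
      (SuperHopf.mem_invariants_of_isPointedCoalgebra h)⟩
  -- Pointedness is pulled back from the case B = 0, where the tensor is trivially invariant.
  · exact .of_equiv e.toCoalgEquiv
      (SuperHopf.isPointedCoalgebra_of_mem_invariants (B := 0) (zero_mem _))
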